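/- Let $n\ge 1$ and let $\mathcal F$ be a field of rational functions in $n$ indeterminates over $\mathbb Q$. A (coefficient-free) labeled seed in $\mathcal F$ is a pair $(\mathbf x,B)$, where the cluster $\mathbf x=(x_1,\dots,x_n)$ is an algebraically independent $n$-tuple generating the field $\mathcal F$ over $\mathbb Q$ and $B=(b_{ij})$ is a skew-symmetrizable integer $n\times n$ matrix. Writing $[a]_+=\max(a,0)$, its mutation in direction $k$ is the seed $(\mathbf x',B')$ with $x'_i=x_i$ for $i\ne k$, $$x'_k=x_k^{-1}\Bigl(\prod_{j=1}^n x_j^{[b_{jk}]_+}+\prod_{j=1}^n x_j^{[-b_{jk}]_+}\Bigr),$$ and $b'_{ij}=-b_{ij}$ if $i=k$ or $j=k$, $b'_{ij}=b_{ij}+[b_{ik}]_+b_{kj}+b_{ik}[-b_{kj}]_+$ otherwise. Consider all seeds obtained from one labeled seed by finite sequences of mutations; the entries of their clusters are the cluster variables of the associated coefficient-free cluster algebra. The cluster algebra is of type $A_n$ if, for one of these seeds $(\mathbf x,B)$, the matrix with diagonal entries $2$ and off-diagonal entries $-|b_{ij}|$ is, up to a simultaneous permutation of rows and columns, the Cartan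 matrix of type $A_n$. Theorem. In a coefficient-free cluster algebra of type $A_n$, let $\mathbf x=(x_1,\dots,x_n)$ be the cluster of any of its seeds and let $z$ be any cluster variable. Then $z$ has a unique expression $z=\sum_{m\in\mathbb Z^n}a_m\,x_1^{m_1}\cdots x_n^{m_n}$ as a Laurent polynomial in $\mathbf x$ with integer coefficients, and this Laurent polynomial is log-concave: it is nonzero, all $a_m\ge 0$, and for every $1\le j\le n$ and every $m\in\mathbb Z^n$ $$a_m^2\ \ge\ a_{m-e_j}\,a_{m+e_j},$$ where $e_j$ is the $j$-th standard basis vector. Moreover, if $a_m\ne 0$ then $m_j\in\{-1,0,1\}$ for all $j$; and if $m_j=0$ and $a_{m-e_j}\neq 0\neq a_{m+e_j}$, then $a_{m-e_j}=a_{m+e_j}=1$ and $a_m=2$. -/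

import Mathlib

/-- The data `(x, B)` of a labeled seed of rank `n` with trivial coefficients in a field `F`:
an `n`-tuple of elements of `F` (the cluster) and an integer `n × n` matrix (the exchange matrix).
The conditions that make it a labeled seed are in `Seed.IsLabeledSeed`. -/
structure Seed (n : ℕ) (F : Type*) where
  cluster : Fin n → F
  matrix : Matrix (Fin n) (Fin n) ℤ

/-- `B` is skew-symmetrizable: `D * B` is skew-symmetric for some diagonal matrix `D` with positive
integer diagonal entries. -/
def IsSkewSymmetrizable {n : ℕ} (B : Matrix (Fin n) (Fin n) ℤ) : Prop :=
  ∃ d : Fin n → ℤ, (∀ i, 0 < d i) ∧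
    (Matrix.diagonal d * B).transpose = -(Matrix.diagonal d * B)

/-- Matrix mutation in direction `k`. -/
def mutateMatrix {n : ℕ} (k : Fin n) (B : Matrix (Fin n) (Fin n) ℤ) :
    Matrix (Fin n) (Fin n) ℤ :=
  Matrix.of fun i j =>
    if i = k ∨ j = k then -B i j
    else B i j + max (B i k) 0 * B k j + B i k * max (-B k j) 0

/-- The Cartan counterpart of an exchange matrix: `2` on the diagonal and `-|b i j|` off it. -/
def cartanCounterpart {n : ℕ} (B : Matrix (Fin n) (Fin n) ℤ) : Matrix (Fin n) (Fin n) ℤ :=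
  Matrix.of fun i j => if i = j then 2 else -|B i j|

/-- A Cartan matrix is of type `A_n` if a simultaneous renumbering of its rows and columns turns it
into the standard one (the Dynkin diagram is a path on the `n` vertices). -/
def IsCartanOfTypeA {n : ℕ} (C : Matrix (Fin n) (Fin n) ℤ) : Prop :=
  ∃ σ : Equiv.Perm (Fin n), C.submatrix σ σ = CartanMatrix.A n

namespace Seed

/-- `(x, B)` is a labeled seed of the ambient field `F`: the cluster is algebraically independent
over `ℚ` and generates `F` as a field (so that `F` is a field of rational functions in `n`
indeterminates over `ℚ`), and `B` is skew-symmetrizable. -/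
def IsLabeledSeed {n : ℕ} {F : Type*} [Field F] [CharZero F] (S : Seed n F) : Prop :=
  AlgebraicIndependent ℚ S.cluster ∧
    IntermediateField.adjoin ℚ (Set.range S.cluster) = ⊤ ∧
    IsSkewSymmetrizable S.matrix

/-- Mutation of a coefficient-free seed in direction `k`. -/
def mutate {n : ℕ} {F : Type*} [Field F] (k : Fin n) (S : Seed n F) : Seed n F where
  cluster := fun i =>
    if i = k then
      (S.cluster k)⁻¹ * (∏ j, S.cluster j ^ max (S.matrix j k) 0 +
        ∏ j, S.cluster j ^ max (-S.matrix j k) 0)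
    else S.cluster i
  matrix := mutateMatrix k S.matrix

/-- `S.MutatesTo S'`: a finite (possibly empty) sequence of mutations leads from `S` to `S'`.
For a labeled seed `S`, the seeds `S'` are exactly those of the cluster pattern through `S`,
since the vertices of the `n`-regular tree are the end points of the edge paths from a vertex. -/
def MutatesTo {n : ℕ} {F : Type*} [Field F] (S S' : Seed n F) : Prop :=
  Relation.ReflTransGen (fun R R' : Seed n F => ∃ k, R' = R.mutate k) S S'

/-- The cluster algebra of the cluster pattern through `S` is of type `A_n`: one of its exchange
matrices has Cartan counterpart of type `A_n`. -/
def IsOfTypeA {n : ℕ} {F : Type*} [Field F] (S : Seed n F) : Prop :=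
  ∃ S' : Seed n F, S.MutatesTo S' ∧ IsCartanOfTypeA (cartanCounterpart S'.matrix)

end Seed

/-- Laurent polynomials over `R` in `n` variables: finite `R`-linear combinations of exponent
vectors in `ℤ^n`. -/
abbrev MvLaurent (n : ℕ) (R : Type*) [Semiring R] : Type _ := AddMonoidAlgebra R (Fin n → ℤ)

/-- The value at `x` of a Laurent polynomial with integer coefficients. -/
def MvLaurent.eval {n : ℕ} {F : Type*} [Field F] (x : Fin n → F) (f : MvLaurent n ℤ) : F :=
  f.coeff.sum fun m c => (c : F) * ∏ j, x j ^ m j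

/-- A Laurent polynomial is log-concave if it is nonzero with non-negative coefficients and in each
variable direction the square of every coefficient is at least the product of its two
neighbours. -/
def MvLaurent.IsLogConcave {n : ℕ} {R : Type*} [Semiring R] [PartialOrder R]
    (f : MvLaurent n R) : Prop :=
  f ≠ 0 ∧ (∀ m, 0 ≤ f.coeff m) ∧
    ∀ (j : Fin n) (m : Fin n → ℤ),
      f.coeff (m - Pi.single j 1) * f.coeff (m + Pi.single j 1) ≤ f.coeff m ^ 2

/-! ### Labeled seeds are stable under mutation, and mutation is reversible. -/

section LabeledSeeds

variable {n : ℕ} {F : Type*} [Field F]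

/-! Seeds of type $A_n$ are triangulations of a polygon with $n+3$ vertices. Attach to the vertices
vectors of $F^2$ whose determinants along the sides are $1$. Cluster variables are then the
determinants $|ab|$ along diagonals, mutation is a flip, and the exchange relation is the three-term
Plücker (Ptolemy) relation (`exists_isModel`, `IsModel.mutate`).

Fix a triangulation and a chord $ab$ crossing its diagonal $k = uw$. Ptolemy gives $x_k|ab| =
|au||bw| + |aw||bu|$. Apart from $x_k$, the expansions $U, W$ of $|au|, |aw|$ involve only diagonals
on the side of $a$, and the expansions $U', W'$ of $|bu|, |bw|$ only those on the side of $b$. So a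
coefficient of the product is a sum of at most four products of coefficients. What must be
controlled is how $U$ and $W$ depend on $x_k$. The invariant `HalfExpansion` says that the exponent
of $x_k$ is $0$ or $1$, that at most one of $U, W$ involves $x_k$, and that coefficients of $U$ and
$W$ at equal or adjacent exponents either exclude each other or are both $1$. It holds for the first
triangle, and it survives the passage to the next crossed diagonal because its clauses feed one
another (`HalfExpansion.step`). After gluing the two sides, nonzero coefficients at exponents $-1$
and $1$ of $x_k$ force the pattern $1, 2, 1$ (`HalfExpansion.glue_pattern`).

Each crossed diagonal yields an expansion patterned in its own variable, while uncrossed variables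
only have exponents $0$ and $1$. By algebraic independence all these expansions coincide, so a
single Laurent polynomial is patterned in every variable. The only nontrivial case of log-concavity
is then $1\cdot 1\le 2^2$. -/

theorem isSkewSymmetrizable_iff {B : Matrix (Fin n) (Fin n) ℤ} :
    IsSkewSymmetrizable B ↔
      ∃ d : Fin n → ℤ, (∀ i, 0 < d i) ∧ ∀ i j, d j * B j i = -(d i * B i j) := by
  unfold IsSkewSymmetrizable
  refine exists_congr fun d => and_congr_right fun _ => ?_
  rw [← Matrix.ext_iff]
  simp [Matrix.diagonal_mul]

theorem IsSkewSymmetrizable.diag_eq_zero {B : Matrix (Fin n) (Fin n) ℤ}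
    (h : IsSkewSymmetrizable B) (k : Fin n) : B k k = 0 := by
  obtain ⟨d, hd, h⟩ := isSkewSymmetrizable_iff.1 h
  have h1 := h k k
  have h2 : d k * B k k = 0 := by linarith
  exact (mul_eq_zero.1 h2).resolve_left (hd k).ne'

theorem mul_max_of_pos {d x : ℤ} (hd : 0 < d) : d * max x 0 = max (d * x) 0 := by
  rw [mul_max_of_nonneg _ _ hd.le, mul_zero]

/-- The same symmetrizer `d` works, since multiplication by a positive integer commutes with taking
positive parts. -/
theorem IsSkewSymmetrizable.mutateMatrix {B : Matrix (Fin n) (Fin n) ℤ}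
    (h : IsSkewSymmetrizable B) (k : Fin n) : IsSkewSymmetrizable (mutateMatrix k B) := by
  obtain ⟨d, hd, h⟩ := isSkewSymmetrizable_iff.1 h
  refine isSkewSymmetrizable_iff.2 ⟨d, hd, fun i j => ?_⟩
  simp only [_root_.mutateMatrix, Matrix.of_apply]
  by_cases hij : i = k ∨ j = k
  · rw [if_pos hij, if_pos hij.symm]
    have := h i j
    linarith
  · rw [if_neg hij, if_neg fun h' => hij h'.symm]
    have hik := h i k
    have hjk := h j k
    have e1 : d j * max (B j k) 0 = d k * max (-B k j) 0 := by
      rw [mul_max_of_pos (hd j), mul_max_of_pos (hd k)]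
      congr 1
      linarith
    have e2 : d i * max (B i k) 0 = d k * max (-B k i) 0 := by
      rw [mul_max_of_pos (hd i), mul_max_of_pos (hd k)]
      congr 1
      linarith
    linear_combination h i j + B k i * e1 + B k j * e2 + max (-B k j) 0 * hik
      + max (-B k i) 0 * hjk

theorem mutateMatrix_mutateMatrix (k : Fin n) (B : Matrix (Fin n) (Fin n) ℤ) :
    mutateMatrix k (mutateMatrix k B) = B := by
  ext i j
  simp only [mutateMatrix, Matrix.of_apply]
  by_cases hij : i = k ∨ j = k
  · simp [hij]
  · have key : ∀ x : ℤ, max x 0 = x + max (-x) 0 := fun x => by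
      rcases le_total x 0 with h | h
      · rw [max_eq_right h, max_eq_left (by linarith)]; ring
      · rw [max_eq_left h, max_eq_right (by linarith)]; ring
    simp only [hij, if_false, or_true, true_or, if_true, neg_neg]
    linear_combination B k j * key (B i k) - B i k * key (B k j)

theorem Seed.mutate_cluster_of_ne (S : Seed n F) {k i : Fin n} (h : i ≠ k) :
    (S.mutate k).cluster i = S.cluster i := by
  simp [Seed.mutate, h]

theorem Seed.mutate_cluster_self (S : Seed n F) (k : Fin n) :
    (S.mutate k).cluster k = (S.cluster k)⁻¹ * (∏ j, S.cluster j ^ max (S.matrix j k) 0 +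
        ∏ j, S.cluster j ^ max (-S.matrix j k) 0) := by
  simp [Seed.mutate]

theorem Seed.prod_mutate_cluster_zpow (S : Seed n F) (k : Fin n) {e : Fin n → ℤ} (he : e k = 0) :
    ∏ j, (S.mutate k).cluster j ^ e j = ∏ j, S.cluster j ^ e j := by
  refine Finset.prod_congr rfl fun j _ => ?_
  by_cases hj : j = k
  · rw [hj, he, zpow_zero, zpow_zero]
  · rw [S.mutate_cluster_of_ne hj]

/-- As $b_{kk}=0$, the exchange monomials do not involve $x_k$; the second mutation merely swaps
them and divides the same sum by $x'_k$. -/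
theorem Seed.mutate_mutate (S : Seed n F) (k : Fin n) (hB : S.matrix k k = 0)
    (h' : (S.mutate k).cluster k ≠ 0) : (S.mutate k).mutate k = S := by
  have hM : (S.mutate k).matrix = mutateMatrix k S.matrix := rfl
  have hcol : ∀ j, (S.mutate k).matrix j k = -S.matrix j k := fun j => by simp [hM, mutateMatrix]
  have hc : ((S.mutate k).mutate k).cluster = S.cluster := by
    funext i
    by_cases hi : i = k
    · subst hi
      rw [Seed.mutate_cluster_self]
      simp only [hcol, neg_neg]
      rw [S.prod_mutate_cluster_zpow i (e := fun j => max (-S.matrix j i) 0) (by simp [hB]),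
        S.prod_mutate_cluster_zpow i (e := fun j => max (S.matrix j i) 0) (by simp [hB]),
        Seed.mutate_cluster_self]
      rw [Seed.mutate_cluster_self] at h'
      have hne := mul_ne_zero_iff.1 h'
      rw [add_comm (∏ j, S.cluster j ^ max (-S.matrix j i) 0)]
      have h1 : S.cluster i ≠ 0 := fun h0 => hne.1 (by rw [h0, inv_zero])
      have h2 := hne.2
      field_simp
    · rw [Seed.mutate_cluster_of_ne _ hi, Seed.mutate_cluster_of_ne _ hi]
  have hm : ((S.mutate k).mutate k).matrix = S.matrix := mutateMatrix_mutateMatrix k S.matrix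
  generalize (S.mutate k).mutate k = T at hc hm
  cases T; cases S; simp_all

variable [CharZero F]

theorem Seed.IsLabeledSeed.cluster_ne_zero {S : Seed n F} (h : S.IsLabeledSeed) (i : Fin n) :
    S.cluster i ≠ 0 :=
  h.1.ne_zero i

/-- The tuple `x` shows that the transcendence degree is at least $n$, so $n$ elements over which
$F$ is algebraic form a transcendence basis. -/
theorem algebraicIndependent_of_adjoin_eq_top {x y : Fin n → F} (hx : AlgebraicIndependent ℚ x)
    (hy : IntermediateField.adjoin ℚ (Set.range y) = ⊤) : AlgebraicIndependent ℚ y := by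
  have halg : Algebra.IsAlgebraic (Algebra.adjoin ℚ (Set.range y)) F := by
    refine ⟨fun z => ?_⟩
    have hz : z ∈ IntermediateField.adjoin ℚ (Set.range y) := hy ▸ IntermediateField.mem_top
    obtain ⟨r, hr, s, hs, rfl⟩ := IntermediateField.mem_adjoin_iff_div.1 hz
    rw [div_eq_mul_inv]
    exact (isAlgebraic_algebraMap (A := F) (⟨r, hr⟩ : Algebra.adjoin ℚ (Set.range y))).mul
      (isAlgebraic_algebraMap (A := F) (⟨s, hs⟩ : Algebra.adjoin ℚ (Set.range y))).inv
  have hle := hx.lift_cardinalMk_le_trdeg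
  exact (Algebra.IsAlgebraic.isTranscendenceBasis_of_lift_le_trdeg_of_finite ℚ y hle).1

/-- The corresponding polynomial takes the value $2$ at $(1,\dots,1)$, so it is not zero. -/
theorem add_prod_zpow_ne_zero {x : Fin n → F} (hx : AlgebraicIndependent ℚ x) {e e' : Fin n → ℤ}
    (he : ∀ j, 0 ≤ e j) (he' : ∀ j, 0 ≤ e' j) : ∏ j, x j ^ e j + ∏ j, x j ^ e' j ≠ 0 := by
  intro h0
  lift e to Fin n → ℕ using he
  lift e' to Fin n → ℕ using he'
  have hp : MvPolynomial.aeval x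
      (∏ j, MvPolynomial.X j ^ e j + ∏ j, MvPolynomial.X j ^ e' j : MvPolynomial (Fin n) ℚ) = 0 := by
    simpa using h0
  have h1 := congrArg (MvPolynomial.eval fun _ => (1 : ℚ)) (hx.eq_zero_of_aeval_eq_zero _ hp)
  norm_num at h1

/-- The old $x_k$ is the exchange sum divided by the new variable, so the new cluster still
generates $F$; independence follows by counting. -/
theorem Seed.IsLabeledSeed.mutate {S : Seed n F} (h : S.IsLabeledSeed) (k : Fin n) :
    (S.mutate k).IsLabeledSeed := by
  have htop : IntermediateField.adjoin ℚ (Set.range (S.mutate k).cluster) = ⊤ := by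
    rw [eq_top_iff, ← h.2.1, IntermediateField.adjoin_le_iff]
    set K := IntermediateField.adjoin ℚ (Set.range (S.mutate k).cluster) with hK
    have hmem : ∀ i, (S.mutate k).cluster i ∈ K := fun i =>
      IntermediateField.subset_adjoin _ _ ⟨i, rfl⟩
    have hprod : ∀ e : Fin n → ℤ, e k = 0 → ∏ j, S.cluster j ^ e j ∈ K := fun e he => by
      rw [← S.prod_mutate_cluster_zpow k he]
      exact prod_mem fun j _ => zpow_mem (hmem j) _
    rintro _ ⟨i, rfl⟩
    by_cases hi : i = k
    · subst hi
      have h0 := h.2.2.diag_eq_zero i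
      have hsum := add_mem (hprod (fun j => max (S.matrix j i) 0) (by simp [h0]))
        (hprod (fun j => max (-S.matrix j i) 0) (by simp [h0]))
      have hx := hmem i
      have hP := add_prod_zpow_ne_zero h.1 (e := fun j => max (S.matrix j i) 0)
        (e' := fun j => max (-S.matrix j i) 0) (fun j => le_max_right _ _) fun j => le_max_right _ _
      have := mul_mem hsum (inv_mem hx)
      rw [Seed.mutate_cluster_self, mul_inv, inv_inv, mul_comm (S.cluster i),
        mul_inv_cancel_left₀ hP] at this
      exact this
    · simpa [S.mutate_cluster_of_ne hi] using hmem i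
  exact ⟨algebraicIndependent_of_adjoin_eq_top h.1 htop, htop, h.2.2.mutateMatrix k⟩

theorem Seed.IsLabeledSeed.of_mutatesTo {S S' : Seed n F} (h : S.IsLabeledSeed)
    (hS : S.MutatesTo S') : S'.IsLabeledSeed := by
  induction hS with
  | refl => exact h
  | tail _ hk ih =>
    obtain ⟨k, rfl⟩ := hk
    exact ih.mutate k

/-- Allows the polygon model, constructed at a seed of type $A$, to be transported back to `S`. -/
theorem Seed.IsLabeledSeed.mutatesTo_symm {S S' : Seed n F} (h : S.IsLabeledSeed)
    (hS : S.MutatesTo S') : S'.MutatesTo S := by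
  induction hS with
  | refl => exact .refl
  | @tail T _ hT hk ih =>
    obtain ⟨k, rfl⟩ := hk
    have hL := h.of_mutatesTo hT
    refine .head ⟨k, ?_⟩ ih
    exact (T.mutate_mutate k (hL.2.2.diag_eq_zero k) ((hL.mutate k).cluster_ne_zero k)).symm

end LabeledSeeds

/-! ### Evaluation of Laurent polynomials and uniqueness of expansions. -/

section LaurentEval

variable {n : ℕ} {F : Type*} [Field F]

/-- The monomials `x ^ m`, as a function of the exponent vector. -/
def zpowHom (x : Fin n → F) (hx : ∀ j, x j ≠ 0) : Multiplicative (Fin n → ℤ) →* F where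
  toFun m := ∏ j, x j ^ m.toAdd j
  map_one' := by simp
  map_mul' a b := by
    rw [← Finset.prod_mul_distrib]
    exact Finset.prod_congr rfl fun j _ => by simp [zpow_add₀ (hx j)]

theorem MvLaurent.eval_eq_lift (x : Fin n → F) (hx : ∀ j, x j ≠ 0) (f : MvLaurent n ℤ) :
    MvLaurent.eval x f = AddMonoidAlgebra.lift ℤ F (Fin n → ℤ) (zpowHom x hx) f := by
  rw [AddMonoidAlgebra.lift_apply']
  simp [MvLaurent.eval, zpowHom]

theorem MvLaurent.eval_add {x : Fin n → F} (hx : ∀ j, x j ≠ 0) (f g : MvLaurent n ℤ) :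
    MvLaurent.eval x (f + g) = MvLaurent.eval x f + MvLaurent.eval x g := by
  simp only [MvLaurent.eval_eq_lift x hx, map_add]

theorem MvLaurent.eval_sub {x : Fin n → F} (hx : ∀ j, x j ≠ 0) (f g : MvLaurent n ℤ) :
    MvLaurent.eval x (f - g) = MvLaurent.eval x f - MvLaurent.eval x g := by
  simp only [MvLaurent.eval_eq_lift x hx, map_sub]

theorem MvLaurent.eval_mul {x : Fin n → F} (hx : ∀ j, x j ≠ 0) (f g : MvLaurent n ℤ) :
    MvLaurent.eval x (f * g) = MvLaurent.eval x f * MvLaurent.eval x g := by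
  simp only [MvLaurent.eval_eq_lift x hx, map_mul]

/-- The Laurent monomial with exponent vector `m`. -/
noncomputable def MvLaurent.mono (m : Fin n → ℤ) : MvLaurent n ℤ := AddMonoidAlgebra.single m 1

theorem MvLaurent.eval_mono (x : Fin n → F) (m : Fin n → ℤ) :
    MvLaurent.eval x (MvLaurent.mono m) = ∏ j, x j ^ m j := by
  simp [MvLaurent.eval, MvLaurent.mono]

theorem MvLaurent.eval_mono_single (x : Fin n → F) (k : Fin n) (e : ℤ) :
    MvLaurent.eval x (MvLaurent.mono (Pi.single k e)) = x k ^ e := by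
  rw [MvLaurent.eval_mono, Finset.prod_eq_single k]
  · simp
  · intro j _ hj
    simp [Pi.single_eq_of_ne hj]
  · simp

theorem MvLaurent.coeff_mul_mono (f : MvLaurent n ℤ) (v m : Fin n → ℤ) :
    (f * MvLaurent.mono v).coeff m = f.coeff (m - v) := by
  rw [MvLaurent.mono, AddMonoidAlgebra.coeff_mul_single_eq_coeff_mul (m - v), mul_one]
  intro m' _
  exact eq_sub_iff_add_eq.symm

theorem MvLaurent.coeff_mono (v m : Fin n → ℤ) :
    (MvLaurent.mono v).coeff m = if v = m then 1 else 0 := by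
  rw [MvLaurent.mono, AddMonoidAlgebra.coeff_single, Finsupp.single_apply]

variable [CharZero F]

/-- Multiplication by a high power of $x_1\cdots x_n$ clears denominators and reduces the claim to
polynomials. -/
theorem MvLaurent.eq_zero_of_eval_eq_zero {x : Fin n → F} (hx : AlgebraicIndependent ℚ x)
    {f : MvLaurent n ℤ} (h : MvLaurent.eval x f = 0) : f = 0 := by
  obtain ⟨N, hN⟩ : ∃ N : ℕ, ∀ m ∈ f.coeff.support, ∀ j, 0 ≤ m j + N := by
    refine ⟨f.coeff.support.sup fun m => Finset.univ.sup fun j => (m j).natAbs, fun m hm j => ?_⟩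
    have h1 := Finset.le_sup (f := fun m : Fin n → ℤ => Finset.univ.sup fun j => (m j).natAbs) hm
    have h2 := Finset.le_sup (f := fun j => (m j).natAbs) (Finset.mem_univ j)
    have h3 := h2.trans h1
    omega
  -- The exponent shifted by `N`; no truncation occurs on the support, so the shift is injective
  -- there.
  let s : (Fin n → ℤ) → (Fin n →₀ ℕ) := fun m => Finsupp.equivFunOnFinite.symm fun j =>
    (m j + N).toNat
  have hs : ∀ m ∈ f.coeff.support, ∀ m' ∈ f.coeff.support, s m = s m' → m = m' := by
    intro m hm m' hm' heq
    funext j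
    have h1 := hN m hm j
    have h2 := hN m' hm' j
    have h3 : (m j + N).toNat = (m' j + N).toNat := DFunLike.congr_fun heq j
    omega
  let p : MvPolynomial (Fin n) ℚ :=
    ∑ m ∈ f.coeff.support, MvPolynomial.monomial (s m) (f.coeff m : ℚ)
  have hp : MvPolynomial.aeval x p = MvLaurent.eval x f * ∏ j, x j ^ (N : ℤ) := by
    simp only [p, map_sum, MvPolynomial.aeval_monomial, MvLaurent.eval, Finsupp.sum,
      Finset.sum_mul]
    refine Finset.sum_congr rfl fun m hm => ?_
    rw [mul_assoc, ← Finset.prod_mul_distrib, Finsupp.prod_fintype _ _ (by simp)]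
    congr 1
    · simp
    · refine Finset.prod_congr rfl fun j _ => ?_
      rw [← zpow_add₀ (hx.ne_zero j), ← zpow_natCast]
      congr 1
      exact Int.toNat_of_nonneg (hN m hm j)
  rw [h, zero_mul] at hp
  have hp0 : p = 0 := hx.eq_zero_of_aeval_eq_zero _ hp
  ext m
  by_contra hm
  have hm' : m ∈ f.coeff.support := Finsupp.mem_support_iff.2 hm
  have hc : p.coeff (s m) = 0 := by rw [hp0, MvPolynomial.coeff_zero]
  simp only [p, MvPolynomial.coeff_sum, MvPolynomial.coeff_monomial] at hc
  rw [Finset.sum_eq_single m] at hc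
  · rw [if_pos rfl] at hc
    exact hm (by exact_mod_cast hc)
  · intro m' hm'' hne
    rw [if_neg fun h => hne (hs _ hm'' _ hm' h)]
  · exact fun h => (h hm').elim

theorem MvLaurent.eval_injective {x : Fin n → F} (hx : AlgebraicIndependent ℚ x) :
    Function.Injective (MvLaurent.eval x) := fun f g h =>
  sub_eq_zero.1 <| MvLaurent.eq_zero_of_eval_eq_zero hx <| by
    rw [MvLaurent.eval_sub hx.ne_zero, h, sub_self]

end LaurentEval

/-! ### The invariant of the expansions on one side of a diagonal. -/

section HalfExpansion

variable {n : ℕ}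

/-- Properties of the Laurent expansions `U`, `W` of the distances from a vertex `a` of a
triangulated polygon to the two ends of the diagonal number `k`: apart from `k`, only variables in
`s` (the diagonals on the side of `a`) occur, and only those in `r` can have negative exponents. -/
structure HalfExpansion (k : Fin n) (s r : Set (Fin n)) (U W : MvLaurent n ℤ) : Prop where
  notMem : k ∉ s
  nonneg_left : ∀ m, 0 ≤ U.coeff m
  nonneg_right : ∀ m, 0 ≤ W.coeff m
  supp_left : ∀ m j, U.coeff m ≠ 0 → j ≠ k → j ∉ s → m j = 0
  supp_right : ∀ m j, W.coeff m ≠ 0 → j ≠ k → j ∉ s → m j = 0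
  exp_left : ∀ m j, U.coeff m ≠ 0 → j ∉ r → m j = 0 ∨ m j = 1
  exp_right : ∀ m j, W.coeff m ≠ 0 → j ∉ r → m j = 0 ∨ m j = 1
  exp_self_left : ∀ m, U.coeff m ≠ 0 → m k = 0 ∨ m k = 1
  exp_self_right : ∀ m, W.coeff m ≠ 0 → m k = 0 ∨ m k = 1
  exp_self : (∀ m, U.coeff m ≠ 0 → m k = 0) ∨ (∀ m, W.coeff m ≠ 0 → m k = 0)
  disj_left : ∀ m, U.coeff m ≠ 0 → W.coeff (m + Pi.single k 1) = 0
  disj_right : ∀ m, W.coeff m ≠ 0 → U.coeff (m + Pi.single k 1) = 0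
  shared : ∀ m, U.coeff m ≠ 0 → W.coeff m ≠ 0 → U.coeff m = 1 ∧ W.coeff m = 1
  succ_left : ∀ m, U.coeff m ≠ 0 → U.coeff (m + Pi.single k 1) ≠ 0 →
    U.coeff m = 1 ∧ U.coeff (m + Pi.single k 1) = 1
  succ_right : ∀ m, W.coeff m ≠ 0 → W.coeff (m + Pi.single k 1) ≠ 0 →
    W.coeff m = 1 ∧ W.coeff (m + Pi.single k 1) = 1

theorem HalfExpansion.swap {k : Fin n} {s r : Set (Fin n)} {U W : MvLaurent n ℤ}
    (h : HalfExpansion k s r U W) : HalfExpansion k s r W U where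
  notMem := h.notMem
  nonneg_left := h.nonneg_right
  nonneg_right := h.nonneg_left
  supp_left := h.supp_right
  supp_right := h.supp_left
  exp_left := h.exp_right
  exp_right := h.exp_left
  exp_self_left := h.exp_self_right
  exp_self_right := h.exp_self_left
  exp_self := h.exp_self.symm
  disj_left := h.disj_right
  disj_right := h.disj_left
  shared m h1 h2 := (h.shared m h2 h1).symm
  succ_left := h.succ_right
  succ_right := h.succ_left

/-- The exponent vector of a variable in `t` or of the constant `1`. -/
def IsVarExponent (t : Set (Fin n)) (c : Fin n → ℤ) : Prop :=
  c = 0 ∨ ∃ j ∈ t, c = Pi.single j 1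

theorem IsVarExponent.apply_eq_zero {t : Set (Fin n)} {c : Fin n → ℤ} (h : IsVarExponent t c)
    {j : Fin n} (hj : j ∉ t) : c j = 0 := by
  rcases h with rfl | ⟨i, hi, rfl⟩
  · rfl
  · exact Pi.single_eq_of_ne (fun e : j = i => hj (e ▸ hi)) 1

theorem IsVarExponent.apply {t : Set (Fin n)} {c : Fin n → ℤ} (h : IsVarExponent t c)
    (j : Fin n) : c j = 0 ∨ c j = 1 := by
  rcases h with rfl | ⟨i, hi, rfl⟩
  · exact .inl rfl
  · by_cases hj : j = i
    · subst hj; simp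
    · left; exact Pi.single_eq_of_ne hj 1

/-- The triangle at `a`: both lengths are variables or $1$, and neither involves $x_k$. -/
theorem HalfExpansion.base {k : Fin n} {s : Set (Fin n)} (r : Set (Fin n)) {c c' : Fin n → ℤ}
    (hk : k ∉ s) (hc : IsVarExponent s c) (hc' : IsVarExponent s c') :
    HalfExpansion k s r (MvLaurent.mono c) (MvLaurent.mono c') := by
  have coeff_ne : ∀ v m : Fin n → ℤ, (MvLaurent.mono v).coeff m ≠ 0 → m = v := fun v m h => by
    by_contra h'
    exact h (by rw [MvLaurent.coeff_mono, if_neg (Ne.symm h')])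
  have coeff_self : ∀ v : Fin n → ℤ, (MvLaurent.mono v).coeff v = 1 := fun v => by
    rw [MvLaurent.coeff_mono, if_pos rfl]
  have nonneg : ∀ v m : Fin n → ℤ, 0 ≤ (MvLaurent.mono v).coeff m := fun v m => by
    rw [MvLaurent.coeff_mono]; split_ifs <;> norm_num
  have hne : ∀ v w : Fin n → ℤ, IsVarExponent s v → IsVarExponent s w →
      (MvLaurent.mono w).coeff (v + Pi.single k 1) = 0 := fun v w hv hw => by
    by_contra h
    have h1 := congrFun (coeff_ne _ _ h) k
    simp [hv.apply_eq_zero hk, hw.apply_eq_zero hk] at h1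
  refine ⟨hk, nonneg c, nonneg c', ?_, ?_, ?_, ?_, ?_, ?_, ?_, ?_, ?_, ?_, ?_, ?_⟩
  · rintro m j hm - hj
    rw [coeff_ne _ _ hm, hc.apply_eq_zero hj]
  · rintro m j hm - hj
    rw [coeff_ne _ _ hm, hc'.apply_eq_zero hj]
  · rintro m j hm -
    rw [coeff_ne _ _ hm]; exact hc.apply j
  · rintro m j hm -
    rw [coeff_ne _ _ hm]; exact hc'.apply j
  · intro m hm
    rw [coeff_ne _ _ hm]; exact hc.apply k
  · intro m hm
    rw [coeff_ne _ _ hm]; exact hc'.apply k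
  · left
    intro m hm
    rw [coeff_ne _ _ hm, hc.apply_eq_zero hk]
  · intro m hm
    rw [coeff_ne _ _ hm, hne _ _ hc hc']
  · intro m hm
    rw [coeff_ne _ _ hm, hne _ _ hc' hc]
  · intro m hm hm'
    have h1 := coeff_ne _ _ hm
    have h2 := coeff_ne _ _ hm'
    exact ⟨h1 ▸ coeff_self m, h2 ▸ coeff_self m⟩
  · intro m hm hm'
    rw [coeff_ne _ _ hm, hne _ _ hc hc] at hm'
    exact (hm' rfl).elim
  · intro m hm hm'
    rw [coeff_ne _ _ hm, hne _ _ hc' hc'] at hm'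
    exact (hm' rfl).elim

/-- Crossing the triangle with sides $k$, $k'$ and $c$ replaces $U$ by $(U x_{k'} + W x_c)/x_k$,
where $x_c = 1$ if $c$ is a side of the polygon. Since $U$ and $W$ are free of $x_{k'}$, the
exponent of $x_{k'}$ tells which summand a term comes from. The new `shared` reduces to the old
`succ_right`, the new `succ_left` to the old `shared`, and the new `disj_right` to the old one; in
the first two, a genuine variable $x_c$ would give incompatible exponents. -/
theorem HalfExpansion.step {k k' : Fin n} {s s' r : Set (Fin n)} {U W : MvLaurent n ℤ}
    (h : HalfExpansion k s r U W) (hk' : k' ∉ s') (hs : s ⊆ s') (hks : k ∈ s') (hkr : k ∈ r)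
    {c : Fin n → ℤ} (hc : IsVarExponent {j | j ∈ s' ∧ j ∉ s ∧ j ≠ k} c) :
    HalfExpansion k' s' r
      ((U * MvLaurent.mono (Pi.single k' 1) + W * MvLaurent.mono c) *
        MvLaurent.mono (Pi.single k (-1))) W := by
  have hkk : k' ≠ k := fun h => hk' (h ▸ hks)
  have hck : c k = 0 := hc.apply_eq_zero fun h => h.2.2 rfl
  have hck' : c k' = 0 := hc.apply_eq_zero fun h => hk' h.1
  have hk's : k' ∉ s := fun h => hk' (hs h)
  have hU0 : ∀ m, U.coeff m ≠ 0 → m k' = 0 := fun m hm => h.supp_left m k' hm hkk hk's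
  have hW0 : ∀ m, W.coeff m ≠ 0 → m k' = 0 := fun m hm => h.supp_right m k' hm hkk hk's
  set U' := (U * MvLaurent.mono (Pi.single k' 1) + W * MvLaurent.mono c) *
        MvLaurent.mono (Pi.single k (-1)) with hU'
  have hcoeff : ∀ m, U'.coeff m =
      U.coeff (m + Pi.single k 1 - Pi.single k' 1) + W.coeff (m + Pi.single k 1 - c) := by
    intro m
    have : m - Pi.single k (-1 : ℤ) = m + Pi.single k 1 := by
      rw [Pi.single_neg, sub_neg_eq_add]
    rw [hU', MvLaurent.coeff_mul_mono, this, AddMonoidAlgebra.coeff_add, Finsupp.add_apply,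
      MvLaurent.coeff_mul_mono, MvLaurent.coeff_mul_mono]
  have hone : ∀ m, m k' ≠ 1 → U'.coeff m = W.coeff (m + Pi.single k 1 - c) := by
    intro m hm
    rw [hcoeff, add_eq_right]
    by_contra h0
    have := hU0 _ h0
    simp [Pi.single_eq_of_ne hkk] at this
    omega
  have hzero : ∀ m, m k' ≠ 0 → U'.coeff m = U.coeff (m + Pi.single k 1 - Pi.single k' 1) := by
    intro m hm
    rw [hcoeff, add_eq_left]
    by_contra h0
    have := hW0 _ h0
    simp [Pi.single_eq_of_ne hkk, hck'] at this
    omega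
  have hcases : ∀ m, U'.coeff m ≠ 0 → (m k' = 1 ∧
      U.coeff (m + Pi.single k 1 - Pi.single k' 1) ≠ 0 ) ∨
      (m k' = 0 ∧ W.coeff (m + Pi.single k 1 - c) ≠ 0) := by
    intro m hm
    by_cases h1 : m k' = 1
    · left
      refine ⟨h1, ?_⟩
      rwa [hzero m (by omega)] at hm
    · right
      rw [hone m h1] at hm
      refine ⟨?_, hm⟩
      have := hW0 _ hm
      simpa [Pi.single_eq_of_ne hkk, hck'] using this
  -- The variable of `c` is new, hence absent from `W`, so a nonzero shift by `c` leaves the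
  -- support.
  have hcW : ∀ m, W.coeff m ≠ 0 → W.coeff (m + Pi.single k 1 - c) ≠ 0 → c = 0 := by
    intro m h1 h2
    rcases hc with rfl | ⟨j, hj, rfl⟩
    · rfl
    · have e1 := h.supp_right _ j h1 hj.2.2 hj.2.1
      have e2 := h.supp_right _ j h2 hj.2.2 hj.2.1
      simp [Pi.single_eq_of_ne hj.2.2, e1] at e2
  have hadd : ∀ m : Fin n → ℤ, m + Pi.single k' 1 + Pi.single k 1 - Pi.single k' 1 =
      m + Pi.single k (1 : ℤ) := fun m => by abel
  refine ⟨hk', ?_, h.nonneg_right, ?_, ?_, ?_, h.exp_right, ?_, ?_, ?_, ?_, ?_, ?_, ?_, ?_⟩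
  · intro m
    rw [hcoeff]
    exact add_nonneg (h.nonneg_left _) (h.nonneg_right _)
  · intro m j hm hj hjs
    have hjk : j ≠ k := fun e => hjs (e ▸ hks)
    have hcj : c j = 0 := hc.apply_eq_zero fun h => hjs h.1
    rcases hcases m hm with ⟨-, h1⟩ | ⟨-, h1⟩
    · simpa [Pi.single_eq_of_ne hj, Pi.single_eq_of_ne hjk] using
        h.supp_left _ j h1 hjk fun e => hjs (hs e)
    · simpa [hcj, Pi.single_eq_of_ne hjk] using
        h.supp_right _ j h1 hjk fun e => hjs (hs e)
  · intro m j hm hj hjs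
    exact h.supp_right m j hm (fun e => hjs (e ▸ hks)) fun e => hjs (hs e)
  · intro m j hm hjr
    have hjk : j ≠ k := fun e => hjr (e ▸ hkr)
    by_cases hjk' : j = k'
    · subst hjk'
      rcases hcases m hm with ⟨h1, -⟩ | ⟨h1, -⟩
      exacts [.inr h1, .inl h1]
    rcases hcases m hm with ⟨-, h1⟩ | ⟨-, h1⟩
    · simpa [Pi.single_eq_of_ne hjk', Pi.single_eq_of_ne hjk] using h.exp_left _ j h1 hjr
    · have h2 := h.exp_right _ j h1 hjr
      simp only [Pi.sub_apply, Pi.add_apply, Pi.single_eq_of_ne hjk, add_zero] at h2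
      rcases hc with rfl | ⟨i, hi, rfl⟩
      · simpa using h2
      · by_cases hji : j = i
        · subst hji
          have h3 := h.supp_right _ j h1 hjk hi.2.1
          simp only [Pi.sub_apply, Pi.add_apply, Pi.single_eq_of_ne hjk, Pi.single_eq_same] at h3
          omega
        · simpa [Pi.single_eq_of_ne hji] using h2
  · intro m hm
    rcases hcases m hm with ⟨h1, -⟩ | ⟨h1, -⟩
    exacts [.inr h1, .inl h1]
  · exact fun m hm => .inl (hW0 m hm)
  · exact .inr hW0
  · intro m hm
    by_contra h0
    have := hW0 _ h0
    simp at this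
    rcases hcases m hm with ⟨h1, -⟩ | ⟨h1, -⟩ <;> omega
  · intro m hm
    have h0 := hW0 m hm
    rw [hzero _ (by simp [h0]), hadd]
    exact h.disj_right m hm
  · intro m hm hW
    rcases hcases m hm with ⟨h1, -⟩ | ⟨h1, h2⟩
    · have := hW0 m hW; omega
    have hc0 := hcW m hW h2
    subst hc0
    rw [sub_zero] at h2
    rw [hone m (by omega), sub_zero]
    exact (h.succ_right m hW h2).symm
  · intro m hm hm'
    rcases hcases m hm with ⟨h1, -⟩ | ⟨h1, h2⟩
    · rcases hcases _ hm' with ⟨h2, -⟩ | ⟨h2, -⟩ <;> simp at h2 <;> omega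
    rw [hzero (m + _) (by simp [h1]), hadd] at hm' ⊢
    rw [hone m (by omega)]
    rcases hc with rfl | ⟨j, hj, rfl⟩
    · rw [sub_zero] at h2 ⊢
      exact (h.shared _ hm' h2).symm
    · have e1 := h.supp_left _ j hm' hj.2.2 hj.2.1
      have e2 := h.supp_right _ j h2 hj.2.2 hj.2.1
      simp only [Pi.sub_apply, Pi.add_apply, Pi.single_eq_same] at e1 e2
      omega
  · intro m hm hm'
    have e1 := hW0 _ hm
    have e2 := hW0 _ hm'
    simp [e1] at e2

/-- Coefficients of a product whose factors share only the variable number `k`. -/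
theorem MvLaurent.coeff_mul_of_separated {k : Fin n} {s : Set (Fin n)} [DecidablePred (· ∈ s)]
    (hk : k ∉ s) {U V : MvLaurent n ℤ}
    (hU : ∀ m j, U.coeff m ≠ 0 → j ≠ k → j ∉ s → m j = 0)
    (hUk : ∀ m, U.coeff m ≠ 0 → m k = 0 ∨ m k = 1)
    (hV : ∀ m j, V.coeff m ≠ 0 → j ∈ s → m j = 0) (m : Fin n → ℤ) :
    (U * V).coeff m =
      U.coeff (fun j => if j ∈ s then m j else 0) *
        V.coeff (fun j => if j ∈ s then 0 else m j) +
      U.coeff ((fun j => if j ∈ s then m j else 0) + Pi.single k 1) *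
        V.coeff ((fun j => if j ∈ s then 0 else m j) - Pi.single k 1) := by
  classical
  set p : Fin n → ℤ := fun j => if j ∈ s then m j else 0 with hp
  have hmp : m - p = fun j => if j ∈ s then 0 else m j := by
    funext j
    by_cases hj : j ∈ s <;> simp [hp, hj]
  rw [← hmp]
  have hsum : (U * V).coeff m = ∑ m₁ ∈ U.coeff.support, U.coeff m₁ * V.coeff (m - m₁) := by
    rw [AddMonoidAlgebra.coeff_mul, Finsupp.sum]
    refine Finset.sum_congr rfl fun m₁ _ => ?_
    rw [Finsupp.sum, Finset.sum_eq_single (m - m₁)]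
    · simp
    · intro b _ hb
      rw [if_neg]
      rintro rfl
      simp at hb
    · intro h
      simp [Finsupp.notMem_support_iff.1 h]
  have hne : p ≠ p + Pi.single k 1 := fun h => by
    have := congrFun h k
    simp at this
  rw [hsum, sub_sub, ← Finset.sum_pair (f := fun m₁ => U.coeff m₁ * V.coeff (m - m₁)) hne]
  refine Finset.sum_congr_of_eq_on_inter ?_ ?_ fun _ _ _ => rfl
  · intro m₁ h1 h2
    by_contra h0
    obtain ⟨hU0, hV0⟩ := mul_ne_zero_iff.1 h0
    apply h2
    -- Away from `k` the variables are separated, so the exponent of the left factor is determined;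
    -- its entry at `k` is $0$ or $1$, which leaves two summands.
    have hoff : ∀ j, j ≠ k → m₁ j = p j := fun j hj => by
      by_cases hjs : j ∈ s
      · have := hV _ j hV0 hjs
        simp only [Pi.sub_apply] at this
        simp only [hp, hjs, if_true]
        omega
      · rw [hU _ j hU0 hj hjs]
        simp [hp, hjs]
    have hpk : p k = 0 := by simp [hp, hk]
    rw [Finset.mem_insert, Finset.mem_singleton]
    refine (hUk _ hU0).imp (fun h => ?_) fun h => ?_
    · funext j
      by_cases hj : j = k
      · rw [hj, h, hpk]
      · exact hoff j hj
    · funext j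
      by_cases hj : j = k
      · rw [hj, h, Pi.add_apply, hpk, Pi.single_eq_same, zero_add]
      · rw [Pi.add_apply, Pi.single_eq_of_ne hj, add_zero, hoff j hj]
  · intro m₁ _ h2
    rw [Finsupp.notMem_support_iff.1 h2, zero_mul]

/-! ### Gluing the expansions from the two sides of a diagonal. -/

section Glue

variable {k : Fin n} {s s' r : Set (Fin n)} {U W U' W' : MvLaurent n ℤ}

theorem ite_mem_add_single [DecidablePred (· ∈ s)] (hk : k ∉ s) (m : Fin n → ℤ) (a : ℤ) :
    (fun j => if j ∈ s then (m + Pi.single k a : Fin n → ℤ) j else 0) =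
      fun j => if j ∈ s then m j else 0 := by
  funext j
  split_ifs with hj
  · simp [Pi.single_eq_of_ne (fun e : j = k => hk (e ▸ hj))]
  · rfl

theorem ite_notMem_add_single [DecidablePred (· ∈ s)] (hk : k ∉ s) (m : Fin n → ℤ) (a : ℤ) :
    (fun j => if j ∈ s then 0 else (m + Pi.single k a : Fin n → ℤ) j) =
      (fun j => if j ∈ s then 0 else m j) + Pi.single k a := by
  funext j
  by_cases hj : j ∈ s
  · simp [hj, Pi.single_eq_of_ne (fun e : j = k => hk (e ▸ hj))]
  · simp [hj]

theorem add_single_add_single (k : Fin n) (m : Fin n → ℤ) (a b : ℤ) :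
    m + Pi.single k a + Pi.single k b = m + Pi.single k (a + b) := by
  rw [add_assoc, ← Pi.single_add]

/-- The Laurent expansion obtained from the expansions on the two sides of the diagonal `k`. -/
noncomputable def MvLaurent.glue (k : Fin n) (U W U' W' : MvLaurent n ℤ) : MvLaurent n ℤ :=
  (U * W' + W * U') * MvLaurent.mono (Pi.single k (-1))

theorem MvLaurent.glue_swap (k : Fin n) (U W U' W' : MvLaurent n ℤ) :
    MvLaurent.glue k W U W' U' = MvLaurent.glue k U W U' W' := by
  rw [MvLaurent.glue, MvLaurent.glue, add_comm]

theorem HalfExpansion.coeff_glue [DecidablePred (· ∈ s)] (h : HalfExpansion k s r U W)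
    (h' : HalfExpansion k s' r U' W') (hd : Disjoint s s') (m : Fin n → ℤ) :
    (MvLaurent.glue k U W U' W').coeff m =
      U.coeff (fun j => if j ∈ s then m j else 0) *
        W'.coeff ((fun j => if j ∈ s then 0 else m j) + Pi.single k 1) +
      U.coeff ((fun j => if j ∈ s then m j else 0) + Pi.single k 1) *
        W'.coeff (fun j => if j ∈ s then 0 else m j) +
      W.coeff (fun j => if j ∈ s then m j else 0) *
        U'.coeff ((fun j => if j ∈ s then 0 else m j) + Pi.single k 1) +
      W.coeff ((fun j => if j ∈ s then m j else 0) + Pi.single k 1) *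
        U'.coeff (fun j => if j ∈ s then 0 else m j) := by
  have hs : ∀ j, j ∈ s → j ≠ k ∧ j ∉ s' := fun j hj =>
    ⟨fun e => h.notMem (e ▸ hj), fun hj' => Set.disjoint_left.1 hd hj hj'⟩
  have e0 : m - Pi.single k (-1 : ℤ) = m + Pi.single k 1 := by
    rw [Pi.single_neg, sub_neg_eq_add]
  rw [MvLaurent.glue, MvLaurent.coeff_mul_mono, e0, AddMonoidAlgebra.coeff_add, Finsupp.add_apply,
    MvLaurent.coeff_mul_of_separated h.notMem h.supp_left h.exp_self_left fun m j hm hj =>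
      h'.supp_right m j hm (hs j hj).1 (hs j hj).2,
    MvLaurent.coeff_mul_of_separated h.notMem h.supp_right h.exp_self_right fun m j hm hj =>
      h'.supp_left m j hm (hs j hj).1 (hs j hj).2, ite_mem_add_single h.notMem, ite_notMem_add_single h.notMem, add_sub_cancel_right]
  ring

theorem HalfExpansion.coeff_glue_nonneg (h : HalfExpansion k s r U W)
    (h' : HalfExpansion k s' r U' W') (hd : Disjoint s s') (m : Fin n → ℤ) :
    0 ≤ (MvLaurent.glue k U W U' W').coeff m := by
  classical
  rw [h.coeff_glue h' hd]
  have := h.nonneg_left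
  have := h.nonneg_right
  have := h'.nonneg_left
  have := h'.nonneg_right
  refine add_nonneg (add_nonneg (add_nonneg ?_ ?_) ?_) ?_ <;> apply mul_nonneg <;> apply_assumption

/-- One of the four terms in `coeff_glue` must be nonzero; this transfers exponent bounds from the
halves to the glued expansion. -/
theorem HalfExpansion.exists_of_coeff_glue_ne_zero [DecidablePred (· ∈ s)]
    (h : HalfExpansion k s r U W)
    (h' : HalfExpansion k s' r U' W') (hd : Disjoint s s') {m : Fin n → ℤ}
    (hm : (MvLaurent.glue k U W U' W').coeff m ≠ 0) :
    ∃ a b : ℤ, (b = 0 ∨ b = 1) ∧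
      (U.coeff ((fun j => if j ∈ s then m j else 0) + Pi.single k a) ≠ 0 ∨
        W.coeff ((fun j => if j ∈ s then m j else 0) + Pi.single k a) ≠ 0) ∧
      (U'.coeff ((fun j => if j ∈ s then 0 else m j) + Pi.single k b) ≠ 0 ∨
        W'.coeff ((fun j => if j ∈ s then 0 else m j) + Pi.single k b) ≠ 0) := by
  rw [h.coeff_glue h' hd] at hm
  by_contra! hcon
  apply hm
  have h01 := hcon 0 1 (.inr rfl)
  have h10 := hcon 1 0 (.inl rfl)
  simp only [Pi.single_zero, add_zero] at h01 h10
  have z1 : ∀ x y z w : ℤ, (x ≠ 0 ∨ z ≠ 0 → w = 0 ∧ y = 0) → x * y = 0 ∧ z * w = 0 := by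
    intro x y z w hh
    by_cases hx : x = 0 <;> by_cases hz : z = 0 <;> simp_all
  have a1 := z1 _ _ _ _ h01
  have a2 := z1 _ _ _ _ h10
  rw [a1.1, a1.2, a2.1, a2.2]
  rfl

theorem HalfExpansion.glue_exponent (h : HalfExpansion k s r U W)
    (h' : HalfExpansion k s' r U' W') (hd : Disjoint s s') (hkr : k ∈ r) {m : Fin n → ℤ}
    (hm : (MvLaurent.glue k U W U' W').coeff m ≠ 0) {j : Fin n} (hj : j ∉ r) :
    m j = 0 ∨ m j = 1 := by
  classical
  obtain ⟨a, b, -, h1, h2⟩ := h.exists_of_coeff_glue_ne_zero h' hd hm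
  have hjk : j ≠ k := fun e => hj (e ▸ hkr)
  by_cases hjs : j ∈ s
  · have := h1.elim (fun e => h.exp_left _ j e hj) fun e => h.exp_right _ j e hj
    simpa [Pi.single_eq_of_ne hjk, hjs] using this
  · have := h2.elim (fun e => h'.exp_left _ j e hj) fun e => h'.exp_right _ j e hj
    simpa [Pi.single_eq_of_ne hjk, hjs] using this

theorem HalfExpansion.glue_exponent_self (h : HalfExpansion k s r U W)
    (h' : HalfExpansion k s' r U' W') (hd : Disjoint s s') {m : Fin n → ℤ}
    (hm : (MvLaurent.glue k U W U' W').coeff m ≠ 0) :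
    m k = -1 ∨ m k = 0 ∨ m k = 1 := by
  classical
  obtain ⟨a, b, hb, h1, h2⟩ := h.exists_of_coeff_glue_ne_zero h' hd hm
  have := h2.elim (fun e => h'.exp_self_left _ e) fun e => h'.exp_self_right _ e
  simp only [Pi.add_apply, h.notMem, if_false, Pi.single_eq_same] at this
  omega

/-- Write `p`, `q` for the parts of `m` inside and outside `s`. As $W$ and $U'$ involve $x_k$, the
polynomials $U$ and $W'$ do not, and `disj_left` also kills $U_p$. The lower coefficient is then
$W_pU'_q$, so the `succ` clauses make $W_p$, $W_{p+e_k}$, $U'_q$, $U'_{q+e_k}$ all equal to $1$. The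
middle coefficient is $W_pU'_{q+e_k}+W_{p+e_k}U'_q = 2$. -/
theorem HalfExpansion.glue_pattern_aux [DecidablePred (· ∈ s)] (h : HalfExpansion k s r U W)
    (h' : HalfExpansion k s' r U' W') (hd : Disjoint s s') {m : Fin n → ℤ} (hmk : m k = 0)
    (hl : (MvLaurent.glue k U W U' W').coeff (m - Pi.single k 1) ≠ 0)
    (hW : W.coeff ((fun j => if j ∈ s then m j else 0) + Pi.single k 1) ≠ 0)
    (hU' : U'.coeff ((fun j => if j ∈ s then 0 else m j) + Pi.single k 1) ≠ 0) :
    (MvLaurent.glue k U W U' W').coeff (m - Pi.single k 1) = 1 ∧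
    (MvLaurent.glue k U W U' W').coeff (m + Pi.single k 1) = 1 ∧
    (MvLaurent.glue k U W U' W').coeff m = 2 := by
  rw [sub_eq_add_neg, ← Pi.single_neg] at hl ⊢
  have em := h.coeff_glue h' hd m
  have ep := h.coeff_glue h' hd (m + Pi.single k 1)
  have en := h.coeff_glue h' hd (m + Pi.single k (-1))
  rw [ite_mem_add_single h.notMem, ite_notMem_add_single h.notMem] at ep en
  rw [add_single_add_single] at ep en
  simp only [neg_add_cancel, Pi.single_zero, add_zero] at en
  set p : Fin n → ℤ := fun j => if j ∈ s then m j else 0 with hp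
  set q : Fin n → ℤ := fun j => if j ∈ s then 0 else m j with hq
  have hpk : p k = 0 := by simp [hp, h.notMem]
  have hqk : q k = 0 := by simp [hq, hmk]
  have hUe : U.coeff (p + Pi.single k 1) = 0 := by
    by_contra h0
    rcases h.exp_self with h1 | h1
    · simpa [hpk] using h1 _ h0
    · simpa [hpk] using h1 _ hW
  have hWe' : W'.coeff (q + Pi.single k 1) = 0 := by
    by_contra h0
    rcases h'.exp_self with h1 | h1
    · simpa [hqk] using h1 _ hU'
    · simpa [hqk] using h1 _ h0
  have hU0 : U.coeff p = 0 := by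
    by_contra h0
    exact hW (h.disj_left p h0)
  have hU'n : U'.coeff (q + Pi.single k (-1)) = 0 := by
    by_contra h0
    have := h'.exp_self_left _ h0
    simp [hqk] at this
  have hU'p : U'.coeff (q + Pi.single k (1 + 1)) = 0 := by
    by_contra h0
    have := h'.exp_self_left _ h0
    simp [hqk] at this
  rw [hU0, hUe, hU'n] at en
  simp only [zero_mul, mul_zero, zero_add, add_zero] at en
  rw [en] at hl
  obtain ⟨hl1, hl2⟩ := mul_ne_zero_iff.1 hl
  obtain ⟨a1, a2⟩ := h.succ_right p hl1 hW
  obtain ⟨a3, a4⟩ := h'.succ_left q hl2 hU'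
  rw [en, ep, em, hU0, hUe, hU'p, a1, a2, a3, a4]
  norm_num

/-- After division by $x_k$, exponent $1$ requires a factor $x_k$ from each half. It is supplied by
$WU'$ or by $UW'$, and these cases are exchanged by `swap`. -/
theorem HalfExpansion.glue_pattern (h : HalfExpansion k s r U W)
    (h' : HalfExpansion k s' r U' W') (hd : Disjoint s s') {m : Fin n → ℤ} (hmk : m k = 0)
    (hl : (MvLaurent.glue k U W U' W').coeff (m - Pi.single k 1) ≠ 0)
    (hr : (MvLaurent.glue k U W U' W').coeff (m + Pi.single k 1) ≠ 0) :
    (MvLaurent.glue k U W U' W').coeff (m - Pi.single k 1) = 1 ∧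
    (MvLaurent.glue k U W U' W').coeff (m + Pi.single k 1) = 1 ∧
    (MvLaurent.glue k U W U' W').coeff m = 2 := by
  classical
  by_cases h1 : W.coeff ((fun j => if j ∈ s then m j else 0) + Pi.single k 1) ≠ 0 ∧
      U'.coeff ((fun j => if j ∈ s then 0 else m j) + Pi.single k 1) ≠ 0
  · exact h.glue_pattern_aux h' hd hmk hl h1.1 h1.2
  by_cases h2 : U.coeff ((fun j => if j ∈ s then m j else 0) + Pi.single k 1) ≠ 0 ∧
      W'.coeff ((fun j => if j ∈ s then 0 else m j) + Pi.single k 1) ≠ 0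
  · have := h.swap.glue_pattern_aux h'.swap hd hmk (by rwa [MvLaurent.glue_swap]) h2.1 h2.2
    rwa [MvLaurent.glue_swap] at this
  exfalso
  apply hr
  have ep := h.coeff_glue h' hd (m + Pi.single k 1)
  rw [ite_mem_add_single h.notMem, ite_notMem_add_single h.notMem, add_single_add_single] at ep
  set p : Fin n → ℤ := fun j => if j ∈ s then m j else 0 with hp
  set q : Fin n → ℤ := fun j => if j ∈ s then 0 else m j with hq
  have hqk : q k = 0 := by simp [hq, hmk]
  have hU'p : U'.coeff (q + Pi.single k (1 + 1)) = 0 := by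
    by_contra h0
    have := h'.exp_self_left _ h0
    simp [hqk] at this
  have hW'p : W'.coeff (q + Pi.single k (1 + 1)) = 0 := by
    by_contra h0
    have := h'.exp_self_right _ h0
    simp [hqk] at this
  rw [not_and_or, not_not, not_not, ← mul_eq_zero] at h1 h2
  rw [ep, hU'p, hW'p, h1, h2]
  norm_num

end Glue

end HalfExpansion

/-! ### Triangulations of the polygon and flips. -/

section Triangulation

variable {n : ℕ}

/-- `(a, b)` is a side of the polygon with vertices `0, …, n + 2` or one of the diagonals `τ i`. -/
def IsEdge (τ : Fin n → ℕ × ℕ) (a b : ℕ) : Prop :=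
  (b = a + 1 ∧ a ≤ n + 1) ∨ (a = 0 ∧ b = n + 2) ∨ ∃ i, τ i = (a, b)

/-- The `τ i` are the diagonals of a triangulation of the polygon with vertices `0, …, n + 2`; a
diagonal is given by its ends in increasing order. -/
structure IsTriangulation (τ : Fin n → ℕ × ℕ) : Prop where
  inj : Function.Injective τ
  add_two_le : ∀ i, (τ i).1 + 2 ≤ (τ i).2
  le : ∀ i, (τ i).2 ≤ n + 2
  ne : ∀ i, τ i ≠ (0, n + 2)
  noncross : ∀ {a b c d}, IsEdge τ a c → IsEdge τ b d → a < b → b < c → c < d → False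
  apex : ∀ {a c}, IsEdge τ a c → a + 2 ≤ c → ∃ b, a < b ∧ b < c ∧ IsEdge τ a b ∧ IsEdge τ b c

variable {τ : Fin n → ℕ × ℕ}

theorem IsEdge.exists_eq {a b : ℕ} (e : IsEdge τ a b) (hab : a + 2 ≤ b)
    (hne : a ≠ 0 ∨ b ≠ n + 2) : ∃ i, τ i = (a, b) := by
  rcases e with ⟨rfl, ha⟩ | ⟨rfl, rfl⟩ | hi
  · omega
  · omega
  · exact hi

namespace IsTriangulation

theorem isEdge_apply (τ : Fin n → ℕ × ℕ) (i : Fin n) : IsEdge τ (τ i).1 (τ i).2 :=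
  .inr (.inr ⟨i, rfl⟩)

theorem lt (h : IsTriangulation τ) {a b : ℕ} (e : IsEdge τ a b) : a < b ∧ b ≤ n + 2 := by
  rcases e with ⟨rfl, ha⟩ | ⟨rfl, rfl⟩ | ⟨i, hi⟩
  · omega
  · omega
  · have h1 := h.add_two_le i
    have h2 := h.le i
    rw [hi] at h1 h2
    simp only at h1 h2
    omega

/-- Descend from the side $(0,n+2)$ through the triangles whose long edge spans $[a,c]$. By
noncrossing no apex falls strictly inside, so the descent arrives at $(a,c)$, and the last triangle
passed is the outer one. -/
theorem outer_apex (h : IsTriangulation τ) {a c : ℕ} (e : IsEdge τ a c)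
    (hne : a ≠ 0 ∨ c ≠ n + 2) :
    (∃ d, c < d ∧ IsEdge τ c d ∧ IsEdge τ a d) ∨ (∃ d, d < a ∧ IsEdge τ d a ∧ IsEdge τ d c) := by
  have key : ∀ N x y, y - x ≤ N → IsEdge τ x y → x ≤ a → c ≤ y → (x ≠ a ∨ y ≠ c) →
      (∃ d, c < d ∧ IsEdge τ c d ∧ IsEdge τ a d) ∨
      (∃ d, d < a ∧ IsEdge τ d a ∧ IsEdge τ d c) := by
    intro N
    induction N with
    | zero =>
      intro x y hN hxy
      have := h.lt hxy
      omega
    | succ N ih =>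
      intro x y hN hxy hxa hcy hne'
      have hac := h.lt e
      obtain ⟨z, hxz, hzy, exz, ezy⟩ := h.apex hxy (by omega)
      by_cases hza : z ≤ a
      · by_cases heq : z = a ∧ y = c
        · obtain ⟨rfl, rfl⟩ := heq
          exact .inr ⟨x, hxz, exz, hxy⟩
        · exact ih z y (by omega) ezy hza hcy (by omega)
      · by_cases hcz : c ≤ z
        · by_cases heq : x = a ∧ z = c
          · obtain ⟨rfl, rfl⟩ := heq
            exact .inl ⟨y, hzy, ezy, hxy⟩
          · exact ih x z (by omega) exz hxa hcz (by omega)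
        · exfalso
          rcases hxa.lt_or_eq with hxa | rfl
          · exact h.noncross exz e hxa (by omega) (by omega)
          · exact h.noncross e ezy (by omega) (by omega) (by omega)
  have hac := h.lt e
  exact key (n + 2) 0 (n + 2) (by omega) (.inr (.inl ⟨rfl, rfl⟩)) (by omega) hac.2 (by omega)

/-- The same descent towards $[a,b]$ must meet an apex strictly between `a` and `b`; an edge from
that apex to an end of the current interval then crosses. -/
theorem exists_cross (h : IsTriangulation τ) {a b : ℕ} (hab : a < b) (hb : b ≤ n + 2)
    (hne : ¬ IsEdge τ a b) : ∃ i, ((τ i).1 < a ∧ a < (τ i).2 ∧ (τ i).2 < b) ∨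
      (a < (τ i).1 ∧ (τ i).1 < b ∧ b < (τ i).2) := by
  have key : ∀ N x y, y - x ≤ N → IsEdge τ x y → x ≤ a → b ≤ y →
      ∃ i, ((τ i).1 < a ∧ a < (τ i).2 ∧ (τ i).2 < b) ∨
      (a < (τ i).1 ∧ (τ i).1 < b ∧ b < (τ i).2) := by
    intro N
    induction N with
    | zero =>
      intro x y hN hxy
      have := h.lt hxy
      omega
    | succ N ih =>
      intro x y hN hxy hxa hby
      have hne' : x ≠ a ∨ y ≠ b := by
        by_contra! hcon
        exact hne (hcon.1 ▸ hcon.2 ▸ hxy)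
      have hxy' := h.lt hxy
      obtain ⟨z, hxz, hzy, exz, ezy⟩ := h.apex hxy (by omega)
      by_cases hza : z ≤ a
      · exact ih z y (by omega) ezy hza hby
      by_cases hbz : b ≤ z
      · exact ih x z (by omega) exz hxa hbz
      rcases hxa.lt_or_eq with hxa | rfl
      · obtain ⟨i, hi⟩ := exz.exists_eq (by omega) (by omega)
        exact ⟨i, .inl (by rw [hi]; simp only; omega)⟩
      · obtain ⟨i, hi⟩ := ezy.exists_eq (by omega) (by omega)
        exact ⟨i, .inr (by rw [hi]; simp only; omega)⟩
  exact key (n + 2) 0 (n + 2) (by omega) (.inr (.inl ⟨rfl, rfl⟩)) (by omega) hb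

theorem isEdge_update (h : IsTriangulation τ) (k : Fin n) (q : ℕ × ℕ) (x y : ℕ) :
    IsEdge (Function.update τ k q) x y ↔ (IsEdge τ x y ∧ (x, y) ≠ τ k) ∨ (x, y) = q := by
  have hlt := h.add_two_le k
  have hk := h.ne k
  constructor
  · rintro (⟨rfl, hx⟩ | ⟨rfl, rfl⟩ | ⟨i, hi⟩)
    · left
      refine ⟨.inl ⟨rfl, hx⟩, fun e => ?_⟩
      rw [← e] at hlt
      simp only at hlt
      omega
    · exact .inl ⟨.inr (.inl ⟨rfl, rfl⟩), hk.symm⟩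
    · by_cases hik : i = k
      · subst hik
        rw [Function.update_self] at hi
        exact .inr hi.symm
      · rw [Function.update_of_ne hik] at hi
        exact .inl ⟨.inr (.inr ⟨i, hi⟩), fun e => hik (h.inj (hi.trans e))⟩
  · rintro (⟨hx | hx | ⟨i, hi⟩, hne⟩ | rfl)
    · exact .inl hx
    · exact .inr (.inl hx)
    · have hik : i ≠ k := fun e => hne (hi ▸ e ▸ rfl)
      exact .inr (.inr ⟨i, by rw [Function.update_of_ne hik, hi]⟩)
    · exact .inr (.inr ⟨k, Function.update_self ..⟩)

theorem injective_update (h : IsTriangulation τ) (k : Fin n) {q : ℕ × ℕ}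
    (hq : ¬ IsEdge τ q.1 q.2) : Function.Injective (Function.update τ k q) := by
  intro i j hij
  by_cases hi : i = k <;> by_cases hj : j = k
  · rw [hi, hj]
  · rw [hi, Function.update_self, Function.update_of_ne hj] at hij
    exact (hq (.inr (.inr ⟨j, hij.symm⟩))).elim
  · rw [hj, Function.update_self, Function.update_of_ne hi] at hij
    exact (hq (.inr (.inr ⟨i, hij⟩))).elim
  · rw [Function.update_of_ne hi, Function.update_of_ne hj] at hij
    exact h.inj hij

end IsTriangulation

/-- The four sides of the quadrilateral with vertices `a < b < c < d` are edges. -/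
structure IsQuad (τ : Fin n → ℕ × ℕ) (a b c d : ℕ) : Prop where
  lt₁ : a < b
  lt₂ : b < c
  lt₃ : c < d
  ab : IsEdge τ a b
  bc : IsEdge τ b c
  cd : IsEdge τ c d
  ad : IsEdge τ a d

namespace IsTriangulation

/-- Replacing `(a, c)` by `(b, d)` is a flip. -/
theorem flip_up (h : IsTriangulation τ) {a b c d : ℕ} (q : IsQuad τ a b c d) {k : Fin n}
    (hk : τ k = (a, c)) : IsTriangulation (Function.update τ k (b, d)) := by
  obtain ⟨lt₁, lt₂, lt₃, ab, bc, cd, ad⟩ := q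
  have hd := (h.lt ad).2
  have hac : IsEdge τ a c := .inr (.inr ⟨k, hk⟩)
  -- An edge crossing $(b,d)$ crosses a side of the quadrilateral or is $(a,c)$ itself.
  have hcross : ∀ {x y}, IsEdge τ x y → (x, y) ≠ τ k → x < b → b < y → y < d → False := by
    intro x y e hne h1 h2 h3
    rw [hk, Ne, Prod.mk.injEq] at hne
    rcases lt_trichotomy y c with hy | rfl | hy
    · exact h.noncross e bc h1 h2 hy
    · rcases lt_trichotomy x a with hx | rfl | hx
      · exact h.noncross e ad hx (by omega) h3
      · exact hne ⟨rfl, rfl⟩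
      · exact h.noncross ab e hx h1 h2
    · exact h.noncross e cd (by omega) hy h3
  have hcross' : ∀ {x y}, IsEdge τ x y → (x, y) ≠ τ k → b < x → x < d → d < y → False := by
    intro x y e hne h1 h2 h3
    exact h.noncross ad e (by omega) h2 h3
  have hbd : ¬ IsEdge τ b d := fun e => h.noncross hac e lt₁ lt₂ lt₃
  refine ⟨h.injective_update k hbd, ?_, ?_, ?_, ?_, ?_⟩
  · intro i
    by_cases hi : i = k
    · rw [hi, Function.update_self]; simp only; omega
    · rw [Function.update_of_ne hi]; exact h.add_two_le i
  · intro i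
    by_cases hi : i = k
    · rw [hi, Function.update_self]; exact hd
    · rw [Function.update_of_ne hi]; exact h.le i
  · intro i
    by_cases hi : i = k
    · rw [hi, Function.update_self, Ne, Prod.mk.injEq]; omega
    · rw [Function.update_of_ne hi]; exact h.ne i
  · intro x y z w e1 e2 h1 h2 h3
    rw [h.isEdge_update, Prod.mk.injEq] at e1 e2
    rcases e1 with ⟨e1, n1⟩ | ⟨rfl, rfl⟩ <;> rcases e2 with ⟨e2, n2⟩ | ⟨rfl, rfl⟩
    · exact h.noncross e1 e2 h1 h2 h3
    · exact hcross e1 n1 h1 h2 h3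
    · exact hcross' e2 n2 h1 h2 h3
    · omega
  · intro x y e hxy
    simp only [h.isEdge_update] at e ⊢
    rcases e with ⟨e, hne⟩ | e
    · obtain ⟨z, hxz, hzy, e1, e2⟩ := h.apex e hxy
      -- A triangle using the removed diagonal as a short edge is $acd$; after the flip its long
      -- edge $(a,d)$ has apex `b`.
      by_cases n1 : (x, z) = τ k
      · rw [hk, Prod.mk.injEq] at n1
        obtain ⟨rfl, rfl⟩ := n1
        have hyd : y = d := by
          rcases lt_trichotomy y d with hy | hy | hy
          · exact (h.noncross e cd (by omega) hzy hy).elim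
          · exact hy
          · exact (h.noncross ad e2 (by omega) (by omega) hy).elim
        subst hyd
        refine ⟨b, lt₁, by omega, .inl ⟨ab, ?_⟩, .inr rfl⟩
        rw [hk, Ne, Prod.mk.injEq]; omega
      · by_cases n2 : (z, y) = τ k
        · rw [hk, Prod.mk.injEq] at n2
          obtain ⟨rfl, rfl⟩ := n2
          exact (h.noncross e ad hxz hzy lt₃).elim
        · exact ⟨z, hxz, hzy, .inl ⟨e1, n1⟩, .inl ⟨e2, n2⟩⟩
    · rw [Prod.mk.injEq] at e
      obtain ⟨rfl, rfl⟩ := e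
      refine ⟨c, lt₂, lt₃, .inl ⟨bc, ?_⟩, .inl ⟨cd, ?_⟩⟩ <;> rw [hk, Ne, Prod.mk.injEq] <;> omega

/-- Replacing `(b, d)` by `(a, c)` is a flip. -/
theorem flip_down (h : IsTriangulation τ) {a b c d : ℕ} (q : IsQuad τ a b c d) {k : Fin n}
    (hk : τ k = (b, d)) : IsTriangulation (Function.update τ k (a, c)) := by
  obtain ⟨lt₁, lt₂, lt₃, ab, bc, cd, ad⟩ := q
  have hd := (h.lt ad).2
  have hbd : IsEdge τ b d := .inr (.inr ⟨k, hk⟩)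
  have hcross : ∀ {x y}, IsEdge τ x y → (x, y) ≠ τ k → x < a → a < y → y < c → False := by
    intro x y e hne h1 h2 h3
    exact h.noncross e ad h1 h2 (by omega)
  have hcross' : ∀ {x y}, IsEdge τ x y → (x, y) ≠ τ k → a < x → x < c → c < y → False := by
    intro x y e hne h1 h2 h3
    rw [hk, Ne, Prod.mk.injEq] at hne
    rcases lt_trichotomy x b with hx | rfl | hx
    · exact h.noncross ab e h1 hx (by omega)
    · rcases lt_trichotomy y d with hy | rfl | hy
      · exact h.noncross e cd h2 h3 hy
      · exact hne ⟨rfl, rfl⟩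
      · exact h.noncross ad e h1 (by omega) hy
    · exact h.noncross bc e hx h2 h3
  have hac : ¬ IsEdge τ a c := fun e => h.noncross e hbd lt₁ lt₂ lt₃
  refine ⟨h.injective_update k hac, ?_, ?_, ?_, ?_, ?_⟩
  · intro i
    by_cases hi : i = k
    · rw [hi, Function.update_self]; simp only; omega
    · rw [Function.update_of_ne hi]; exact h.add_two_le i
  · intro i
    by_cases hi : i = k
    · rw [hi, Function.update_self]; simp only; omega
    · rw [Function.update_of_ne hi]; exact h.le i
  · intro i
    by_cases hi : i = k
    · rw [hi, Function.update_self, Ne, Prod.mk.injEq]; omega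
    · rw [Function.update_of_ne hi]; exact h.ne i
  · intro x y z w e1 e2 h1 h2 h3
    rw [h.isEdge_update, Prod.mk.injEq] at e1 e2
    rcases e1 with ⟨e1, n1⟩ | ⟨rfl, rfl⟩ <;> rcases e2 with ⟨e2, n2⟩ | ⟨rfl, rfl⟩
    · exact h.noncross e1 e2 h1 h2 h3
    · exact hcross e1 n1 h1 h2 h3
    · exact hcross' e2 n2 h1 h2 h3
    · omega
  · intro x y e hxy
    simp only [h.isEdge_update] at e ⊢
    rcases e with ⟨e, hne⟩ | e
    · obtain ⟨z, hxz, hzy, e1, e2⟩ := h.apex e hxy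
      by_cases n1 : (x, z) = τ k
      · rw [hk, Prod.mk.injEq] at n1
        obtain ⟨rfl, rfl⟩ := n1
        exact (h.noncross ad e lt₁ hxz hzy).elim
      · by_cases n2 : (z, y) = τ k
        · rw [hk, Prod.mk.injEq] at n2
          obtain ⟨rfl, rfl⟩ := n2
          have hxa : x = a := by
            rcases lt_trichotomy x a with hx | hx | hx
            · exact (h.noncross e1 ad hx lt₁ hzy).elim
            · exact hx
            · exact (h.noncross ab e hx hxz hzy).elim
          subst hxa
          refine ⟨c, by omega, lt₃, .inr rfl, .inl ⟨cd, ?_⟩⟩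
          rw [hk, Ne, Prod.mk.injEq]; omega
        · exact ⟨z, hxz, hzy, .inl ⟨e1, n1⟩, .inl ⟨e2, n2⟩⟩
    · rw [Prod.mk.injEq] at e
      obtain ⟨rfl, rfl⟩ := e
      refine ⟨b, lt₁, lt₂, .inl ⟨ab, ?_⟩, .inl ⟨bc, ?_⟩⟩ <;> rw [hk, Ne, Prod.mk.injEq] <;> omega

/-- Every diagonal is a diagonal of a quadrilateral. -/
theorem exists_quad (h : IsTriangulation τ) (k : Fin n) : ∃ a b c d, IsQuad τ a b c d ∧
    (τ k = (a, c) ∨ τ k = (b, d)) := by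
  have e := isEdge_apply τ k
  obtain ⟨z, h1, h2, e1, e2⟩ := h.apex e (h.add_two_le k)
  have hne : (τ k).1 ≠ 0 ∨ (τ k).2 ≠ n + 2 := by
    by_contra! hcon
    exact h.ne k (Prod.ext hcon.1 hcon.2)
  rcases h.outer_apex e hne with ⟨d, hd, e3, e4⟩ | ⟨d, hd, e3, e4⟩
  · exact ⟨_, z, _, d, ⟨h1, h2, hd, e1, e2, e3, e4⟩, .inl rfl⟩
  · exact ⟨d, _, z, _, ⟨hd, h1, h2, e3, e1, e2, e4⟩, .inr rfl⟩

end IsTriangulation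

end Triangulation

/-! ### Signed adjacency matrices: a flip is a matrix mutation. -/

section AdjacencyMatrix

variable {n : ℕ}

/-- `q` follows `p` in the counterclockwise boundary of a triangle of the triangulation. -/
def Follows (τ : Fin n → ℕ × ℕ) (p q : ℕ × ℕ) : Prop :=
  (p.2 = q.1 ∧ IsEdge τ p.1 q.2) ∨ (p.2 = q.2 ∧ q.1 < p.1 ∧ IsEdge τ q.1 p.1) ∨
    (p.1 = q.1 ∧ q.2 < p.2 ∧ IsEdge τ q.2 p.2)

open Classical in
/-- The indicator function of `Follows`. -/
noncomputable def followsInd (τ : Fin n → ℕ × ℕ) (p q : ℕ × ℕ) : ℤ :=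
  if Follows τ p q then 1 else 0

/-- The signed adjacency matrix of a triangulation. -/
noncomputable def adjMatrix (τ : Fin n → ℕ × ℕ) : Matrix (Fin n) (Fin n) ℤ :=
  Matrix.of fun i j => followsInd τ (τ i) (τ j) - followsInd τ (τ j) (τ i)

/-- The indicator function of the edge `e`. -/
def edgeInd (e p : ℕ × ℕ) : ℤ := if p = e then 1 else 0

variable {τ τ' : Fin n → ℕ × ℕ} {a b c d : ℕ} {p q : ℕ × ℕ}

/-- Only the triangles $abc$ and $acd$ contain $(a,c)$: any other third vertex would produce a
crossing with a side of the quadrilateral. The next three lemmas hold for the same reason. -/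
theorem follows_lower (h : IsTriangulation τ) (hq : IsQuad τ a b c d)
    (hp : IsEdge τ p.1 p.2) : Follows τ p (a, c) ↔ p = (b, c) ∨ p = (a, d) := by
  obtain ⟨lt₁, lt₂, lt₃, ab, bc, cd, ad⟩ := hq
  obtain ⟨x, y⟩ := p
  have hlt := h.lt hp
  simp only [Follows, Prod.mk.injEq] at hp hlt ⊢
  constructor
  · rintro (⟨rfl, e⟩ | ⟨rfl, h1, e⟩ | ⟨rfl, h1, e⟩)
    · exact (h.noncross e ad hlt.1 (by omega) (by omega)).elim
    · left
      refine ⟨?_, rfl⟩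
      rcases lt_trichotomy x b with hx | hx | hx
      · exact (h.noncross ab hp h1 hx lt₂).elim
      · exact hx
      · exact (h.noncross e bc lt₁ hx hlt.1).elim
    · right
      refine ⟨rfl, ?_⟩
      rcases lt_trichotomy y d with hy | hy | hy
      · exact (h.noncross hp cd (by omega) h1 hy).elim
      · exact hy
      · exact (h.noncross ad e (by omega) lt₃ hy).elim
  · rintro (⟨rfl, rfl⟩ | ⟨rfl, rfl⟩)
    · exact .inr (.inl ⟨rfl, lt₁, ab⟩)
    · exact .inr (.inr ⟨rfl, lt₃, cd⟩)

theorem lower_follows (h : IsTriangulation τ) (hq : IsQuad τ a b c d)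
    (hp : IsEdge τ p.1 p.2) : Follows τ (a, c) p ↔ p = (a, b) ∨ p = (c, d) := by
  obtain ⟨lt₁, lt₂, lt₃, ab, bc, cd, ad⟩ := hq
  obtain ⟨x, y⟩ := p
  have hlt := h.lt hp
  simp only [Follows, Prod.mk.injEq] at hp hlt ⊢
  constructor
  · rintro (⟨rfl, e⟩ | ⟨rfl, h1, e⟩ | ⟨rfl, h1, e⟩)
    · right
      refine ⟨rfl, ?_⟩
      rcases lt_trichotomy y d with hy | hy | hy
      · exact (h.noncross e cd (by omega) hlt.1 hy).elim
      · exact hy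
      · exact (h.noncross ad hp (by omega) lt₃ hy).elim
    · exact (h.noncross hp ad h1 (by omega) lt₃).elim
    · left
      refine ⟨rfl, ?_⟩
      rcases lt_trichotomy y b with hy | hy | hy
      · exact (h.noncross ab e hlt.1 hy (by omega)).elim
      · exact hy
      · exact (h.noncross hp bc lt₁ hy h1).elim
  · rintro (⟨rfl, rfl⟩ | ⟨rfl, rfl⟩)
    · exact .inr (.inr ⟨rfl, lt₂, bc⟩)
    · exact .inl ⟨rfl, ad⟩

theorem follows_upper (h : IsTriangulation τ) (hq : IsQuad τ a b c d)
    (hp : IsEdge τ p.1 p.2) : Follows τ p (b, d) ↔ p = (a, b) ∨ p = (c, d) := by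
  obtain ⟨lt₁, lt₂, lt₃, ab, bc, cd, ad⟩ := hq
  obtain ⟨x, y⟩ := p
  have hlt := h.lt hp
  simp only [Follows, Prod.mk.injEq] at hp hlt ⊢
  constructor
  · rintro (⟨rfl, e⟩ | ⟨rfl, h1, e⟩ | ⟨rfl, h1, e⟩)
    · left
      refine ⟨?_, rfl⟩
      rcases lt_trichotomy x a with hx | hx | hx
      · exact (h.noncross hp ad hx lt₁ (by omega)).elim
      · exact hx
      · exact (h.noncross ab e hx hlt.1 (by omega)).elim
    · right
      refine ⟨?_, rfl⟩
      rcases lt_trichotomy x c with hx | hx | hx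
      · exact (h.noncross bc hp h1 hx lt₃).elim
      · exact hx
      · exact (h.noncross e cd lt₂ hx hlt.1).elim
    · exact (h.noncross ad hp lt₁ (by omega) h1).elim
  · rintro (⟨rfl, rfl⟩ | ⟨rfl, rfl⟩)
    · exact .inl ⟨rfl, ad⟩
    · exact .inr (.inl ⟨rfl, lt₂, bc⟩)

theorem upper_follows (h : IsTriangulation τ) (hq : IsQuad τ a b c d)
    (hp : IsEdge τ p.1 p.2) : Follows τ (b, d) p ↔ p = (b, c) ∨ p = (a, d) := by
  obtain ⟨lt₁, lt₂, lt₃, ab, bc, cd, ad⟩ := hq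
  obtain ⟨x, y⟩ := p
  have hlt := h.lt hp
  simp only [Follows, Prod.mk.injEq] at hp hlt ⊢
  constructor
  · rintro (⟨rfl, e⟩ | ⟨rfl, h1, e⟩ | ⟨rfl, h1, e⟩)
    · exact (h.noncross ad e lt₁ (by omega) (by omega)).elim
    · right
      refine ⟨?_, rfl⟩
      rcases lt_trichotomy x a with hx | hx | hx
      · exact (h.noncross e ad hx lt₁ (by omega)).elim
      · exact hx
      · exact (h.noncross ab hp hx h1 (by omega)).elim
    · left
      refine ⟨rfl, ?_⟩
      rcases lt_trichotomy y c with hy | hy | hy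
      · exact (h.noncross bc e hlt.1 hy (by omega)).elim
      · exact hy
      · exact (h.noncross hp cd lt₂ hy h1).elim
  · rintro (⟨rfl, rfl⟩ | ⟨rfl, rfl⟩)
    · exact .inr (.inr ⟨rfl, lt₃, cd⟩)
    · exact .inr (.inl ⟨rfl, lt₁, ab⟩)

/-- How `Follows` changes when the diagonal `(a, c)` is replaced by `(b, d)`. -/
theorem follows_flip (h : IsTriangulation τ) (hq : IsQuad τ a b c d)
    (hE : ∀ x y, IsEdge τ' x y ↔ (IsEdge τ x y ∧ (x, y) ≠ (a, c)) ∨ (x, y) = (b, d))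
    (hp : IsEdge τ p.1 p.2) (hp' : IsEdge τ q.1 q.2) :
    Follows τ' p q ↔
      (Follows τ p q ∧ ¬ (p = (a, b) ∧ q = (b, c)) ∧ ¬ (p = (c, d) ∧ q = (a, d))) ∨
      (p = (a, d) ∧ q = (a, b)) ∨ (p = (b, c) ∧ q = (c, d)) := by
  obtain ⟨lt₁, lt₂, lt₃, ab, bc, cd, ad⟩ := hq
  obtain ⟨x, y⟩ := p
  obtain ⟨z, w⟩ := q
  have hlt := h.lt hp
  have hlt' := h.lt hp'
  simp only [Follows, hE, ne_eq, Prod.mk.injEq] at hp hp' hlt hlt' ⊢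
  constructor
  · rintro (⟨rfl, e⟩ | ⟨rfl, h1, e⟩ | ⟨rfl, h1, e⟩)
    · rcases e with ⟨e, hne⟩ | ⟨rfl, rfl⟩
      · exact .inl ⟨.inl ⟨rfl, e⟩, by omega, by omega⟩
      · rcases lt_trichotomy y c with hy | rfl | hy
        · exact (h.noncross bc hp' hlt.1 hy lt₃).elim
        · exact .inr (.inr ⟨⟨rfl, rfl⟩, rfl, rfl⟩)
        · exact (h.noncross hp cd lt₂ hy hlt'.1).elim
    · rcases e with ⟨e, hne⟩ | ⟨rfl, rfl⟩
      · exact .inl ⟨.inr (.inl ⟨rfl, h1, e⟩), by omega, by omega⟩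
      · exact (h.noncross ad hp' lt₁ h1 hlt.1).elim
    · rcases e with ⟨e, hne⟩ | ⟨rfl, rfl⟩
      · exact .inl ⟨.inr (.inr ⟨rfl, h1, e⟩), by omega, by omega⟩
      · rcases lt_trichotomy x a with hx | rfl | hx
        · exact (h.noncross hp' ad hx lt₁ h1).elim
        · exact .inr (.inl ⟨⟨rfl, rfl⟩, rfl, rfl⟩)
        · exact (h.noncross ab hp hx hlt'.1 h1).elim
  · rintro (⟨⟨rfl, e⟩ | ⟨rfl, h1, e⟩ | ⟨rfl, h1, e⟩, n1, n2⟩ | ⟨⟨rfl, rfl⟩, rfl, rfl⟩ |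
      ⟨⟨rfl, rfl⟩, rfl, rfl⟩)
    · refine .inl ⟨rfl, .inl ⟨e, ?_⟩⟩
      rintro ⟨rfl, rfl⟩
      rcases lt_trichotomy y b with hy | hy | hy
      · exact h.noncross ab hp' hlt.1 hy lt₂
      · omega
      · exact h.noncross hp bc lt₁ hy hlt'.1
    · refine .inr (.inl ⟨rfl, h1, .inl ⟨e, ?_⟩⟩)
      rintro ⟨rfl, rfl⟩
      rcases lt_trichotomy y d with hy | hy | hy
      · exact h.noncross hp' cd h1 hlt.1 hy
      · omega
      · exact h.noncross ad hp h1 lt₃ hy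
    · refine .inr (.inr ⟨rfl, h1, .inl ⟨e, ?_⟩⟩)
      rintro ⟨rfl, rfl⟩
      exact h.noncross hp ad hlt'.1 h1 lt₃
    · exact .inr (.inr ⟨rfl, by omega, .inr ⟨rfl, rfl⟩⟩)
    · exact .inl ⟨rfl, .inr ⟨rfl, rfl⟩⟩

/-- The two negative products are the adjacencies lost with the triangles $abc$, $acd$; the two
positive ones are those gained with $abd$, $bcd$. -/
theorem followsInd_flip (h : IsTriangulation τ) (hq : IsQuad τ a b c d) (hac : IsEdge τ a c)
    (hE : ∀ x y, IsEdge τ' x y ↔ (IsEdge τ x y ∧ (x, y) ≠ (a, c)) ∨ (x, y) = (b, d))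
    (hp : IsEdge τ p.1 p.2) (hp' : IsEdge τ q.1 q.2) :
    followsInd τ' p q = followsInd τ p q - edgeInd (a, b) p * edgeInd (b, c) q
      - edgeInd (c, d) p * edgeInd (a, d) q + edgeInd (a, d) p * edgeInd (a, b) q
      + edgeInd (b, c) p * edgeInd (c, d) q := by
  classical
  have key := follows_flip h hq hE hp hp'
  obtain ⟨lt₁, lt₂, lt₃, ab, bc, cd, ad⟩ := hq
  have hbd : ¬ IsEdge τ b d := fun e => h.noncross hac e lt₁ lt₂ lt₃
  have mul_ite : ∀ P Q : Prop, ∀ [Decidable P] [Decidable Q],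
      (if P then (1 : ℤ) else 0) * (if Q then 1 else 0) = if P ∧ Q then 1 else 0 := by
    intro P Q _ _
    by_cases hP : P <;> by_cases hQ : Q <;> simp [hP, hQ]
  simp only [followsInd, edgeInd, mul_ite]
  by_cases h1 : p = (a, b) ∧ q = (b, c)
  · obtain ⟨rfl, rfl⟩ := h1
    have hF : Follows τ (a, b) (b, c) := .inl ⟨rfl, hac⟩
    have hF' : ¬ Follows τ' (a, b) (b, c) := by rw [key]; simp; omega
    have n1 : a ≠ c := by omega
    have n2 : b ≠ a := by omega
    simp [hF, hF', lt₁.ne, n1, n2, lt₂.ne]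
  by_cases h2 : p = (c, d) ∧ q = (a, d)
  · obtain ⟨rfl, rfl⟩ := h2
    have hF : Follows τ (c, d) (a, d) := .inr (.inl ⟨rfl, by simp only; omega, hac⟩)
    have hF' : ¬ Follows τ' (c, d) (a, d) := by rw [key]; simp; omega
    have n1 : c ≠ a := by omega
    have n2 : a ≠ b := by omega
    have n3 : c ≠ b := by omega
    simp [hF, hF', n1, n2, n3]
  by_cases h3 : p = (a, d) ∧ q = (a, b)
  · obtain ⟨rfl, rfl⟩ := h3
    have hF : ¬ Follows τ (a, d) (a, b) := by
      rintro (⟨h, -⟩ | ⟨h, -⟩ | ⟨-, -, e⟩)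
      · simp only at h; omega
      · simp only at h; omega
      · exact hbd e
    have hF' : Follows τ' (a, d) (a, b) := by rw [key]; simp
    have n1 : d ≠ b := by omega
    have n2 : b ≠ d := by omega
    have n3 : a ≠ b := by omega
    have n4 : a ≠ c := by omega
    simp [hF, hF', n1, n2, n3, n4]
  by_cases h4 : p = (b, c) ∧ q = (c, d)
  · obtain ⟨rfl, rfl⟩ := h4
    have hF : ¬ Follows τ (b, c) (c, d) := by
      rintro (⟨-, e⟩ | ⟨h, -⟩ | ⟨h, -⟩)
      · exact hbd e
      · simp only at h; omega
      · simp only at h; omega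
    have hF' : Follows τ' (b, c) (c, d) := by rw [key]; simp
    have n1 : b ≠ a := by omega
    have n2 : b ≠ c := by omega
    have n3 : c ≠ a := by omega
    simp [hF, hF', n1, n2, n3]
  have key' : Follows τ' p q ↔ Follows τ p q := by
    rw [key]
    exact ⟨fun h => h.elim (·.1) fun h => h.elim (fun h => (h3 h).elim) fun h => (h4 h).elim,
      fun h => .inl ⟨h, h1, h2⟩⟩
  simp [h1, h2, h3, h4, key']

theorem ite_or_eq_edgeInd {e e' : ℕ × ℕ} (hne : e ≠ e') [Decidable (p = e ∨ p = e')] :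
    (if p = e ∨ p = e' then (1 : ℤ) else 0) = edgeInd e p + edgeInd e' p := by
  unfold edgeInd
  by_cases h1 : p = e
  · subst h1
    simp [hne]
  · by_cases h2 : p = e' <;> simp [h1, h2, hne.symm]

variable {k : Fin n}

theorem adjMatrix_lower (h : IsTriangulation τ) (hq : IsQuad τ a b c d) (hk : τ k = (a, c))
    (i : Fin n) : adjMatrix τ i k =
      (edgeInd (b, c) (τ i) + edgeInd (a, d) (τ i)) -
        (edgeInd (a, b) (τ i) + edgeInd (c, d) (τ i)) := by
  classical
  have hi := IsTriangulation.isEdge_apply τ i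
  have n1 : (b, c) ≠ (a, d) := by
    rw [Ne, Prod.mk.injEq]; have := hq.lt₁; omega
  have n2 : (a, b) ≠ (c, d) := by
    rw [Ne, Prod.mk.injEq]; have := hq.lt₁; have := hq.lt₂; omega
  simp only [adjMatrix, Matrix.of_apply, hk, followsInd, follows_lower h hq hi,
    lower_follows h hq hi, ite_or_eq_edgeInd n1, ite_or_eq_edgeInd n2]

theorem adjMatrix_upper (h : IsTriangulation τ) (hq : IsQuad τ a b c d) (hk : τ k = (b, d))
    (i : Fin n) : adjMatrix τ i k =
      (edgeInd (a, b) (τ i) + edgeInd (c, d) (τ i)) -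
        (edgeInd (b, c) (τ i) + edgeInd (a, d) (τ i)) := by
  classical
  have hi := IsTriangulation.isEdge_apply τ i
  have n1 : (b, c) ≠ (a, d) := by
    rw [Ne, Prod.mk.injEq]; have := hq.lt₁; omega
  have n2 : (a, b) ≠ (c, d) := by
    rw [Ne, Prod.mk.injEq]; have := hq.lt₁; have := hq.lt₂; omega
  simp only [adjMatrix, Matrix.of_apply, hk, followsInd, follows_upper h hq hi,
    upper_follows h hq hi, ite_or_eq_edgeInd n1, ite_or_eq_edgeInd n2]

theorem adjMatrix_neg (τ : Fin n → ℕ × ℕ) (i j : Fin n) : adjMatrix τ i j = -adjMatrix τ j i := by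
  simp [adjMatrix]

/-- The positive part of a difference of indicators of disjoint pairs of sides. -/
theorem max_edgeInd_sub (hq : IsQuad τ a b c d) (p : ℕ × ℕ) :
    max ((edgeInd (b, c) p + edgeInd (a, d) p) - (edgeInd (a, b) p + edgeInd (c, d) p)) 0 =
      edgeInd (b, c) p + edgeInd (a, d) p ∧
    max ((edgeInd (a, b) p + edgeInd (c, d) p) - (edgeInd (b, c) p + edgeInd (a, d) p)) 0 =
      edgeInd (a, b) p + edgeInd (c, d) p := by
  obtain ⟨lt₁, lt₂, lt₃, -, -, -, -⟩ := hq
  have hpos : ∀ e, 0 ≤ edgeInd e p := fun e => by unfold edgeInd; split_ifs <;> norm_num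
  have hdisj : (edgeInd (b, c) p + edgeInd (a, d) p = 0) ∨
      (edgeInd (a, b) p + edgeInd (c, d) p = 0) := by
    obtain ⟨x, y⟩ := p
    simp only [edgeInd, Prod.mk.injEq]
    split_ifs <;> omega
  have h1 := hpos (a, b)
  have h2 := hpos (b, c)
  have h3 := hpos (c, d)
  have h4 := hpos (a, d)
  omega

/-- With $P$ the indicator of $\{bc, ad\}$ and $Q$ that of $\{ab, cd\}$, column $k$ is $P-Q$ with
positive part $P$. The mutation correction is therefore $P_iQ_j - Q_iP_j$, which is exactly the
change computed in `followsInd_flip`. -/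
theorem mutateMatrix_adjMatrix (h : IsTriangulation τ) (h' : IsTriangulation τ')
    (hq : IsQuad τ a b c d) (hq' : IsQuad τ' a b c d) (hk : τ k = (a, c)) (hk' : τ' k = (b, d))
    (hne : ∀ i, i ≠ k → τ' i = τ i)
    (hE : ∀ x y, IsEdge τ' x y ↔ (IsEdge τ x y ∧ (x, y) ≠ (a, c)) ∨ (x, y) = (b, d)) :
    adjMatrix τ' = mutateMatrix k (adjMatrix τ) := by
  have hkk : ∀ σ : Fin n → ℕ × ℕ, adjMatrix σ k k = 0 := fun σ => by simp [adjMatrix]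
  have hcol : ∀ i, adjMatrix τ' i k = -adjMatrix τ i k := fun i => by
    by_cases hi : i = k
    · rw [hi, hkk, hkk, neg_zero]
    · rw [adjMatrix_upper h' hq' hk', adjMatrix_lower h hq hk, hne i hi]
      ring
  ext i j
  rw [mutateMatrix, Matrix.of_apply]
  split_ifs with hij
  · rcases hij with rfl | rfl
    · rw [adjMatrix_neg, hcol, adjMatrix_neg τ i j]
    · exact hcol i
  · push Not at hij
    have hi := IsTriangulation.isEdge_apply τ i
    have hj := IsTriangulation.isEdge_apply τ j
    have hac : IsEdge τ a c := .inr (.inr ⟨k, hk⟩)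
    have e1 := followsInd_flip h hq hac hE hi hj
    have e2 := followsInd_flip h hq hac hE hj hi
    rw [adjMatrix_neg τ k j, neg_neg, adjMatrix_lower h hq hk, adjMatrix_lower h hq hk,
      (max_edgeInd_sub hq (τ i)).1, (max_edgeInd_sub hq (τ j)).1]
    simp only [adjMatrix, Matrix.of_apply]
    rw [hne i hij.1, hne j hij.2, e1, e2]
    ring

end AdjacencyMatrix

/-! ### Cluster variables as determinants; mutations as flips. -/

section PolygonModel

variable {n : ℕ} {F : Type*} [Field F]

/-- The determinant of the vectors attached to two vertices. -/
def vdet (v : ℕ → F × F) (a b : ℕ) : F := (v a).1 * (v b).2 - (v a).2 * (v b).1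

/-- The sides of the polygon with vertices `0, …, n + 2` have length one. -/
def HasUnitSides (n : ℕ) (v : ℕ → F × F) : Prop :=
  (∀ a, a ≤ n + 1 → vdet v a (a + 1) = 1) ∧ vdet v 0 (n + 2) = 1

theorem vdet_mul_vdet (v : ℕ → F × F) (a b c d : ℕ) :
    vdet v a c * vdet v b d = vdet v b c * vdet v a d + vdet v a b * vdet v c d := by
  unfold vdet
  ring

/-- The seed `S` consists of the lengths of the diagonals of a triangulation and of its signed
adjacency matrix. -/
def IsModel (v : ℕ → F × F) (S : Seed n F) : Prop :=
  ∃ τ : Fin n → ℕ × ℕ, IsTriangulation τ ∧ (∀ i, S.cluster i = vdet v (τ i).1 (τ i).2) ∧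
    S.matrix = adjMatrix τ

/-- For a polygon side the product is empty, which is right because sides have length $1$; thus
boundary edges need no coefficients. -/
theorem prod_zpow_edgeInd {τ : Fin n → ℕ × ℕ} (h : IsTriangulation τ) {v : ℕ → F × F}
    (hv : HasUnitSides n v) {x : Fin n → F} (hx : ∀ i, x i = vdet v (τ i).1 (τ i).2) {a b : ℕ}
    (hab : IsEdge τ a b) : ∏ j, x j ^ edgeInd (a, b) (τ j) = vdet v a b := by
  by_cases hi : ∃ i, τ i = (a, b)
  · obtain ⟨i, hi⟩ := hi
    rw [Finset.prod_eq_single i]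
    · simp [edgeInd, hi, hx]
    · intro j _ hj
      have : τ j ≠ (a, b) := fun e => hj (h.inj (e.trans hi.symm))
      simp [edgeInd, this]
    · simp
  · have h1 : ∏ j, x j ^ edgeInd (a, b) (τ j) = 1 := Finset.prod_eq_one fun j _ => by
      have : τ j ≠ (a, b) := fun e => hi ⟨j, e⟩
      simp [edgeInd, this]
    rw [h1]
    rcases hab with ⟨rfl, ha⟩ | ⟨rfl, rfl⟩ | hab
    · exact (hv.1 a ha).symm
    · exact hv.2.symm
    · exact (hi hab).elim

theorem prod_zpow_edgeInd_add {τ : Fin n → ℕ × ℕ} (h : IsTriangulation τ) {v : ℕ → F × F}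
    (hv : HasUnitSides n v) {x : Fin n → F} (hx0 : ∀ i, x i ≠ 0)
    (hx : ∀ i, x i = vdet v (τ i).1 (τ i).2) {a b c d : ℕ}
    (hab : IsEdge τ a b) (hcd : IsEdge τ c d) :
    ∏ j, x j ^ (edgeInd (a, b) (τ j) + edgeInd (c, d) (τ j)) = vdet v a b * vdet v c d := by
  simp only [zpow_add₀ (hx0 _), Finset.prod_mul_distrib]
  rw [prod_zpow_edgeInd h hv hx hab, prod_zpow_edgeInd h hv hx hcd]

theorem isQuad_update {τ : Fin n → ℕ × ℕ} (h : IsTriangulation τ) {a b c d : ℕ}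
    (hq : IsQuad τ a b c d) {k : Fin n} (hk : τ k = (a, c) ∨ τ k = (b, d)) (q : ℕ × ℕ) :
    IsQuad (Function.update τ k q) a b c d := by
  obtain ⟨lt₁, lt₂, lt₃, ab, bc, cd, ad⟩ := hq
  refine ⟨lt₁, lt₂, lt₃, ?_, ?_, ?_, ?_⟩ <;>
  · rw [h.isEdge_update]
    refine .inl ⟨by assumption, fun e => ?_⟩
    rw [← e, Prod.mk.injEq, Prod.mk.injEq] at hk
    omega

/-- The exchange monomials at `k` are the products of opposite sides of the quadrilateral around `τ
k`, so the new variable is the other diagonal by the Plücker relation. -/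
theorem IsModel.mutate {v : ℕ → F × F} (hv : HasUnitSides n v) {S : Seed n F} (hS : IsModel v S)
    (h0 : ∀ i, S.cluster i ≠ 0) (k : Fin n) : IsModel v (S.mutate k) := by
  obtain ⟨τ, h, hx, hB⟩ := hS
  obtain ⟨a, b, c, d, hq, hk⟩ := h.exists_quad k
  have hp1 := prod_zpow_edgeInd_add h hv h0 hx hq.bc hq.ad
  have hp2 := prod_zpow_edgeInd_add h hv h0 hx hq.ab hq.cd
  have hcl : ∀ q : ℕ × ℕ, (S.cluster k)⁻¹ * (∏ j, S.cluster j ^ max (S.matrix j k) 0 +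
      ∏ j, S.cluster j ^ max (-S.matrix j k) 0) = vdet v q.1 q.2 →
      ∀ i, (S.mutate k).cluster i =
        vdet v (Function.update τ k q i).1 (Function.update τ k q i).2 := by
    intro q hq i
    by_cases hi : i = k
    · rw [hi, Seed.mutate_cluster_self, Function.update_self, hq]
    · rw [Seed.mutate_cluster_of_ne _ hi, Function.update_of_ne hi, hx]
  have hxk := hx k
  have hne := h0 k
  rcases hk with hk | hk
  · have h' := h.flip_up hq hk
    refine ⟨_, h', hcl (b, d) ?_, ?_⟩
    · simp only [hB, adjMatrix_lower h hq hk, neg_sub, (max_edgeInd_sub hq _).1,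
        (max_edgeInd_sub hq _).2]
      rw [hp1, hp2, ← vdet_mul_vdet, hxk, hk, inv_mul_cancel_left₀]
      rwa [hxk, hk] at hne
    · change mutateMatrix k S.matrix = _
      rw [hB]
      refine (mutateMatrix_adjMatrix h h' hq (isQuad_update h hq (.inl hk) _) hk
        (Function.update_self ..) (fun i hi => Function.update_of_ne hi ..) fun x y => ?_).symm
      rw [h.isEdge_update, hk]
  · have h' := h.flip_down hq hk
    have hq' := isQuad_update h hq (.inr hk) (a, c)
    -- The matrix of this flip is obtained from the opposite flip, since matrix mutation is an
    -- involution.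
    have hτ : Function.update (Function.update τ k (a, c)) k (b, d) = τ := by
      rw [Function.update_idem, ← hk, Function.update_eq_self]
    refine ⟨_, h', hcl (a, c) ?_, ?_⟩
    · simp only [hB, adjMatrix_upper h hq hk, neg_sub, (max_edgeInd_sub hq _).1,
        (max_edgeInd_sub hq _).2]
      rw [hp1, hp2, add_comm, ← vdet_mul_vdet, mul_comm (vdet v a c), hxk, hk,
        inv_mul_cancel_left₀]
      rwa [hxk, hk] at hne
    · change mutateMatrix k S.matrix = _
      rw [hB]
      have := mutateMatrix_adjMatrix h' h hq' hq (Function.update_self ..) hk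
        (fun i hi => (Function.update_of_ne hi ..).symm) fun x y => by
          have := h'.isEdge_update k (b, d) x y
          rwa [hτ, Function.update_self] at this
      rw [this, mutateMatrix_mutateMatrix]

theorem IsModel.of_mutatesTo [CharZero F] {v : ℕ → F × F} (hv : HasUnitSides n v) {S S' : Seed n F}
    (hS : IsModel v S) (hL : S.IsLabeledSeed) (h : S.MutatesTo S') : IsModel v S' := by
  induction h with
  | refl => exact hS
  | tail hT hk ih =>
    obtain ⟨k, rfl⟩ := hk
    exact ih.mutate hv (hL.of_mutatesTo hT).cluster_ne_zero k

end PolygonModel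

/-! ### A polygon model for a seed with Cartan counterpart of type $A_n$. -/

section InitialSeed

variable {n : ℕ} {F : Type*} [Field F]

/-- The left ends of a sequence of nested intervals `[l i, l i + i + 2]`, the last of which is
`[0, n + 2]`. -/
def IsNested (n : ℕ) (l : ℕ → ℕ) : Prop :=
  l n = 0 ∧ ∀ i, i < n → l i = l (i + 1) ∨ l i = l (i + 1) + 1

theorem IsNested.mono {l : ℕ → ℕ} (h : IsNested n l) {i j : ℕ} (hij : i ≤ j) (hj : j ≤ n) :
    l j ≤ l i ∧ l i + i ≤ l j + j := by
  induction j, hij using Nat.le_induction with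
  | base => omega
  | succ j hij ih =>
    have h1 := ih (by omega)
    have h2 := h.2 j (by omega)
    omega

/-- Each interval adds one vertex, whose vector has prescribed determinants with the two ends of the
previous interval. This is a linear system with determinant $\pm x_k \ne 0$, solved explicitly. -/
theorem IsNested.exists_vdet {l : ℕ → ℕ} (h : IsNested n l) {x : ℕ → F} (hx : ∀ i, i < n → x i ≠ 0)
    {k : ℕ} (hk : k ≤ n) :
    ∃ v : ℕ → F × F, (∀ a, l k ≤ a → a < l k + k + 2 → vdet v a (a + 1) = 1) ∧
      ∀ i, i ≤ k → vdet v (l i) (l i + i + 2) = x i := by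
  induction k with
  | zero =>
    refine ⟨fun a => if a = l 0 then (1, 0) else if a = l 0 + 1 then (0, 1) else (-1, x 0), ?_, ?_⟩
    · intro a h1 h2
      obtain rfl | rfl : a = l 0 ∨ a = l 0 + 1 := by omega
      · simp [vdet]
      · have ne : l 0 + 1 + 1 ≠ l 0 := by omega
        simp [vdet, ne]
    · intro i hi
      obtain rfl : i = 0 := by omega
      simp [vdet]
  | succ k ih =>
    obtain ⟨v, hv1, hv2⟩ := ih (by omega)
    have hxk : vdet v (l k) (l k + k + 2) ≠ 0 := by
      rw [hv2 k le_rfl]; exact hx k (by omega)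
    have hup : ∀ (w : F × F) (m a b : ℕ), a ≠ m → b ≠ m →
        vdet (Function.update v m w) a b = vdet v a b := fun w m a b ha hb => by
      simp [vdet, Function.update_of_ne ha, Function.update_of_ne hb]
    rcases h.2 k (by omega) with hl | hl
    · set w : F × F := ((x (k + 1) * (v (l k + k + 2)).1 - (v (l k)).1) /
          vdet v (l k) (l k + k + 2), (x (k + 1) * (v (l k + k + 2)).2 - (v (l k)).2) /
          vdet v (l k) (l k + k + 2)) with hw
      refine ⟨Function.update v (l k + k + 3) w, ?_, ?_⟩
      · intro a h1 h2
        by_cases ha : a = l k + k + 2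
        · subst ha
          simp only [vdet, Function.update_self, Function.update_of_ne (Nat.ne_of_lt
            (Nat.lt_succ_self (l k + k + 2))), hw]
          rw [vdet] at hxk
          rw [← mul_div_assoc, ← mul_div_assoc, ← sub_div, div_eq_one_iff_eq hxk]
          ring
        · rw [hup _ _ _ _ (by omega) (by omega)]
          exact hv1 a (by omega) (by omega)
      · intro i hi
        rcases hi.lt_or_eq with hi | rfl
        · have := h.mono (show i ≤ k by omega) (by omega)
          rw [hup _ _ _ _ (by omega) (by omega)]
          exact hv2 i (by omega)
        · have e : l (k + 1) + (k + 1) + 2 = l k + k + 3 := by omega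
          rw [e, ← hl]
          have ne : l k ≠ l k + k + 3 := by omega
          simp only [vdet, Function.update_self, Function.update_of_ne ne, hw]
          rw [vdet] at hxk
          rw [← mul_div_assoc, ← mul_div_assoc, ← sub_div, div_eq_iff hxk]
          ring
    · set w : F × F := ((x (k + 1) * (v (l k)).1 - (v (l k + k + 2)).1) /
          vdet v (l k) (l k + k + 2), (x (k + 1) * (v (l k)).2 - (v (l k + k + 2)).2) /
          vdet v (l k) (l k + k + 2)) with hw
      refine ⟨Function.update v (l (k + 1)) w, ?_, ?_⟩
      · intro a h1 h2
        by_cases ha : a = l (k + 1)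
        · subst ha
          have ne : l k ≠ l (k + 1) := by omega
          rw [← hl]
          simp only [vdet, Function.update_self, Function.update_of_ne ne, hw]
          rw [vdet] at hxk
          rw [div_mul_eq_mul_div, div_mul_eq_mul_div, ← sub_div, div_eq_one_iff_eq hxk]
          ring
        · rw [hup _ _ _ _ (by omega) (by omega)]
          exact hv1 a (by omega) (by omega)
      · intro i hi
        rcases hi.lt_or_eq with hi | rfl
        · have := h.mono (show i ≤ k by omega) (by omega)
          rw [hup _ _ _ _ (by omega) (by omega)]
          exact hv2 i (by omega)
        · have e : l (k + 1) + (k + 1) + 2 = l k + k + 2 := by omega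
          rw [e]
          have ne : l k + k + 2 ≠ l (k + 1) := by omega
          simp only [vdet, Function.update_self, Function.update_of_ne ne, hw]
          rw [vdet] at hxk
          rw [div_mul_eq_mul_div, div_mul_eq_mul_div, ← sub_div, div_eq_iff hxk]
          ring

/-- The triangulation by nested diagonals; the diagonal number `i` has the label `σ i`. -/
def nestedDiagonals (l : ℕ → ℕ) (σ : Equiv.Perm (Fin n)) (j : Fin n) : ℕ × ℕ :=
  (l (σ.symm j), l (σ.symm j) + σ.symm j + 2)

theorem IsNested.isEdge_iff {l : ℕ → ℕ} (h : IsNested n l) (σ : Equiv.Perm (Fin n)) (a b : ℕ) :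
    IsEdge (nestedDiagonals l σ) a b ↔
      (b = a + 1 ∧ a ≤ n + 1) ∨ ∃ i, i ≤ n ∧ a = l i ∧ b = l i + i + 2 := by
  constructor
  · rintro (h1 | ⟨rfl, rfl⟩ | ⟨j, hj⟩)
    · exact .inl h1
    · exact .inr ⟨n, le_rfl, h.1.symm, by rw [h.1]; omega⟩
    · rw [nestedDiagonals, Prod.mk.injEq] at hj
      exact .inr ⟨σ.symm j, (σ.symm j).2.le, hj.1.symm, hj.2.symm⟩
  · rintro (h1 | ⟨i, hi, rfl, rfl⟩)
    · exact .inl h1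
    · rcases hi.lt_or_eq with hi | rfl
      · exact .inr (.inr ⟨σ ⟨i, hi⟩, by simp [nestedDiagonals]⟩)
      · exact .inr (.inl ⟨h.1, by rw [h.1]; omega⟩)

theorem IsNested.isTriangulation {l : ℕ → ℕ} (h : IsNested n l) (σ : Equiv.Perm (Fin n)) :
    IsTriangulation (nestedDiagonals l σ) := by
  refine ⟨?_, ?_, ?_, ?_, ?_, ?_⟩
  · intro i j hij
    rw [nestedDiagonals, nestedDiagonals, Prod.mk.injEq] at hij
    apply σ.symm.injective
    ext
    omega
  · intro i
    simp only [nestedDiagonals]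
    omega
  · intro i
    have := h.mono (σ.symm i).2.le le_rfl
    have := h.1
    simp only [nestedDiagonals]
    omega
  · intro i e
    rw [nestedDiagonals, Prod.mk.injEq] at e
    have := (σ.symm i).2
    omega
  · intro a b c d e1 e2 h1 h2 h3
    rw [h.isEdge_iff] at e1 e2
    rcases e1 with e1 | ⟨i, hi, rfl, rfl⟩
    · omega
    rcases e2 with e2 | ⟨j, hj, rfl, rfl⟩
    · omega
    rcases le_total i j with hij | hij
    · have := h.mono hij hj
      omega
    · have := h.mono hij hi
      omega
  · intro a c e hac
    simp only [h.isEdge_iff] at e ⊢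
    rcases e with e | ⟨i, hi, rfl, rfl⟩
    · omega
    have hn := h.mono hi le_rfl
    have hn0 := h.1
    cases i with
    | zero => exact ⟨l 0 + 1, by omega, by omega, .inl ⟨rfl, by omega⟩, .inl ⟨rfl, by omega⟩⟩
    | succ i =>
      rcases h.2 i (by omega) with hl | hl
      · refine ⟨l i + i + 2, by omega, by omega, .inr ⟨i, by omega, hl.symm, rfl⟩,
          .inl ⟨by omega, by omega⟩⟩
      · refine ⟨l i, by omega, by omega, .inl ⟨by omega, by omega⟩,
          .inr ⟨i, by omega, rfl, by omega⟩⟩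

/-- Only consecutive nested diagonals share a triangle, and the end they share decides the
orientation: hence a path with arbitrary signs. -/
theorem IsNested.follows_iff {l : ℕ → ℕ} (h : IsNested n l) (σ : Equiv.Perm (Fin n)) {i j : ℕ}
    (hi : i < n) (hj : j < n) :
    Follows (nestedDiagonals l σ) (l i, l i + i + 2) (l j, l j + j + 2) ↔
      (j = i + 1 ∧ l i = l j + 1) ∨ (i = j + 1 ∧ l j = l i) := by
  have hmono : ∀ {i j}, i ≤ n → j ≤ n → (l j ≤ l i ∧ l i + i ≤ l j + j) ∨
      (l i ≤ l j ∧ l j + j ≤ l i + i) := fun {i j} hi hj => by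
    rcases le_total i j with hij | hij
    · exact .inl (h.mono hij hj)
    · exact .inr (h.mono hij hi)
  have hij := hmono hi.le hj.le
  have hi' := h.mono hi.le le_rfl
  have hj' := h.mono hj.le le_rfl
  have hn0 := h.1
  simp only [Follows, h.isEdge_iff]
  constructor
  · rintro (⟨h1, -⟩ | ⟨h1, h2, h3 | ⟨m, hm, h3, h4⟩⟩ | ⟨h1, h2, h3 | ⟨m, hm, h3, h4⟩⟩)
    · omega
    · omega
    · have := hmono hi.le hm; omega
    · omega
    · have := hmono hj.le hm; omega
  · rintro (⟨h1, h2⟩ | ⟨h1, h2⟩)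
    · exact .inr (.inl ⟨by omega, by omega, .inl ⟨by omega, by omega⟩⟩)
    · exact .inr (.inr ⟨by omega, by omega, .inl ⟨by omega, by omega⟩⟩)

/-- The entries of a skew-symmetrizable matrix with Cartan counterpart of type `A`. -/
theorem IsSkewSymmetrizable.typeA_entries {B : Matrix (Fin n) (Fin n) ℤ}
    (hB : IsSkewSymmetrizable B) {σ : Equiv.Perm (Fin n)}
    (hσ : (cartanCounterpart B).submatrix σ σ = CartanMatrix.A n) (i j : Fin n) :
    B (σ j) (σ i) = -B (σ i) (σ j) ∧
    ((i.val + 1 = j.val ∨ j.val + 1 = i.val) → B (σ i) (σ j) = 1 ∨ B (σ i) (σ j) = -1) ∧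
    (¬ (i.val + 1 = j.val ∨ j.val + 1 = i.val) → B (σ i) (σ j) = 0) := by
  by_cases hij : i = j
  · subst hij
    have := hB.diag_eq_zero (σ i)
    rw [this]
    simp
  obtain ⟨d, hd, hs⟩ := isSkewSymmetrizable_iff.1 hB
  have h1 := congrFun (congrFun hσ i) j
  have h2 := congrFun (congrFun hσ j) i
  have h3 := hs (σ i) (σ j)
  have p1 := hd (σ i)
  have p2 := hd (σ j)
  have hij' : σ i ≠ σ j := fun e => hij (σ.injective e)
  simp only [cartanCounterpart, Matrix.submatrix_apply, Matrix.of_apply, hij', hij'.symm, if_false,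
    CartanMatrix.A, hij, Ne.symm hij] at h1 h2
  by_cases hadj : i.val + 1 = j.val ∨ j.val + 1 = i.val
  · rw [if_pos hadj, neg_inj] at h1
    rw [if_pos hadj.symm, neg_inj] at h2
    refine ⟨?_, fun _ => eq_or_eq_neg_of_abs_eq h1, fun h => (h hadj).elim⟩
    -- Both entries are $\pm1$, and a positive symmetrizer forces opposite signs.
    rcases eq_or_eq_neg_of_abs_eq h1 with e1 | e1 <;>
      rcases eq_or_eq_neg_of_abs_eq h2 with e2 | e2 <;> rw [e1, e2] at h3 ⊢ <;> omega
  · rw [if_neg hadj, neg_eq_zero, abs_eq_zero] at h1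
    rw [if_neg fun h => hadj h.symm, neg_eq_zero, abs_eq_zero] at h2
    exact ⟨by rw [h1, h2, neg_zero], fun h => (hadj h).elim, fun _ => h1⟩

/-- The signs along the path dictate whether each interval is extended to the left or to the right;
the vectors then realize the given cluster. -/
theorem exists_isModel [CharZero F] {S : Seed n F} (hS : S.IsLabeledSeed)
    (hA : IsCartanOfTypeA (cartanCounterpart S.matrix)) :
    ∃ v : ℕ → F × F, HasUnitSides n v ∧ IsModel v S := by
  classical
  obtain ⟨σ, hσ⟩ := hA
  have hent := hS.2.2.typeA_entries hσ
  -- `δ i = 1` means that interval `i + 1` is obtained by adding a vertex on the left. No entry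
  -- prescribes the last extension; there `δ` is $0$.
  let δ : ℕ → ℕ := fun i => if ∃ (h : i < n) (h' : i + 1 < n),
    S.matrix (σ ⟨i, h⟩) (σ ⟨i + 1, h'⟩) = 1 then 1 else 0
  let l : ℕ → ℕ := fun i => ∑ j ∈ Finset.Ico i n, δ j
  have hδ : ∀ i, δ i = 0 ∨ δ i = 1 := fun i => by simp only [δ]; split_ifs <;> simp
  have hlδ : ∀ i, i < n → l i = δ i + l (i + 1) := fun i hi =>
    Finset.sum_eq_sum_Ico_succ_bot hi δ
  have hl : IsNested n l := ⟨by simp [l], fun i hi => by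
    have h1 := hlδ i hi
    have h2 := hδ i
    omega⟩
  have hδ1 : ∀ (i : ℕ) (h : i < n) (h' : i + 1 < n),
      S.matrix (σ ⟨i, h⟩) (σ ⟨i + 1, h'⟩) = 2 * δ i - 1 := fun i h h' => by
    have h1 := (hent ⟨i, h⟩ ⟨i + 1, h'⟩).2.1 (.inl rfl)
    by_cases h2 : S.matrix (σ ⟨i, h⟩) (σ ⟨i + 1, h'⟩) = 1
    · have : δ i = 1 := if_pos ⟨h, h', h2⟩
      rw [h2, this]; norm_num
    · have : δ i = 0 := if_neg fun ⟨_, _, h3⟩ => h2 h3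
      rw [h1.resolve_left h2, this]; norm_num
  -- The default value at `i = n` is the length of the side $(0,n+2)$.
  let x : ℕ → F := fun i => if h : i < n then S.cluster (σ ⟨i, h⟩) else 1
  have hx : ∀ i, i < n → x i ≠ 0 := fun i hi => by
    simp only [x, hi, dif_pos]
    exact hS.cluster_ne_zero _
  obtain ⟨v, hv1, hv2⟩ := hl.exists_vdet hx le_rfl
  refine ⟨v, ⟨fun a ha => hv1 a (by rw [hl.1]; omega) (by omega), ?_⟩,
    nestedDiagonals l σ, hl.isTriangulation σ, fun i => ?_, ?_⟩
  · have := hv2 n le_rfl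
    rw [hl.1, zero_add] at this
    simpa [x] using this
  · have := hv2 (σ.symm i) (σ.symm i).2.le
    rw [nestedDiagonals, this]
    simp [x]
  · have hfol : ∀ i j : Fin n, adjMatrix (nestedDiagonals l σ) (σ i) (σ j) =
        (if (j.val = i.val + 1 ∧ l i = l j + 1) ∨ (i.val = j.val + 1 ∧ l j = l i) then 1 else 0) -
        (if (i.val = j.val + 1 ∧ l j = l i + 1) ∨ (j.val = i.val + 1 ∧ l i = l j)
          then 1 else 0) := fun i j => by
      have h1 := hl.follows_iff σ i.2 j.2
      have h2 := hl.follows_iff σ j.2 i.2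
      simp [adjMatrix, followsInd, nestedDiagonals, h1, h2]
    have hadj : ∀ i j : Fin n, i.val + 1 = j.val →
        S.matrix (σ i) (σ j) = adjMatrix (nestedDiagonals l σ) (σ i) (σ j) := fun i j hij => by
      have h1 := hδ1 i i.2 (by omega)
      have h2 : (⟨i.val + 1, by omega⟩ : Fin n) = j := Fin.ext hij
      have h3 := hlδ i i.2
      have h4 := hδ i
      rw [h2] at h1
      rw [hfol, h1, ← hij]
      split_ifs <;> omega
    ext i' j'
    obtain ⟨i, rfl⟩ := σ.surjective i'
    obtain ⟨j, rfl⟩ := σ.surjective j'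
    by_cases h1 : i.val + 1 = j.val
    · exact hadj i j h1
    · by_cases h2 : j.val + 1 = i.val
      · rw [(hent j i).1, hadj j i h2, ← adjMatrix_neg]
      · rw [(hent i j).2.2 (by omega), hfol]
        split_ifs <;> omega

end InitialSeed

/-! ### Laurent expansions of diagonals in a triangulation. -/

section LaurentExpansion

variable {n : ℕ} {F : Type*} [Field F]

/-- The length of the segment between two vertices. -/
def seglen (v : ℕ → F × F) (a b : ℕ) : F := if a < b then vdet v a b else vdet v b a

theorem seglen_of_lt (v : ℕ → F × F) {a b : ℕ} (h : a < b) : seglen v a b = vdet v a b := if_pos h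

theorem seglen_comm (v : ℕ → F × F) (a b : ℕ) : seglen v a b = seglen v b a := by
  rcases lt_trichotomy a b with h | rfl | h
  · simp [seglen, h, h.not_gt]
  · rfl
  · simp [seglen, h, h.not_gt]

/-- The Ptolemy relation. -/
theorem seglen_mul_seglen (v : ℕ → F × F) {a b u w : ℕ} (h1 : u < a) (h2 : a < w)
    (h3 : b < u ∨ w < b) :
    seglen v a b * seglen v u w = seglen v a u * seglen v b w + seglen v a w * seglen v b u := by
  rw [seglen_comm v a u, seglen_of_lt v h1, seglen_of_lt v h2, seglen_of_lt v (h1.trans h2)]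
  rcases h3 with h3 | h3
  · rw [seglen_comm v a b, seglen_of_lt v (h3.trans h1), seglen_of_lt v h3,
      seglen_of_lt v (h3.trans (h1.trans h2))]
    unfold vdet
    ring
  · rw [seglen_of_lt v (h2.trans h3), seglen_comm v b w, seglen_of_lt v h3, seglen_comm v b u,
      seglen_of_lt v ((h1.trans h2).trans h3)]
    unfold vdet
    ring

/-- The vertices `a` and `b` lie strictly on different sides of the diagonal `p`. -/
def Separates (p : ℕ × ℕ) (a b : ℕ) : Prop :=
  (p.1 < a ∧ a < p.2 ∧ (b < p.1 ∨ p.2 < b)) ∨ (p.1 < b ∧ b < p.2 ∧ (a < p.1 ∨ p.2 < a))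

/-- The elements `A`, `B` of the field have Laurent expansions as in `HalfExpansion`. -/
def HasHalfExpansion (x : Fin n → F) (k : Fin n) (s r : Set (Fin n)) (A B : F) : Prop :=
  ∃ U W, HalfExpansion k s r U W ∧ MvLaurent.eval x U = A ∧ MvLaurent.eval x W = B

theorem HasHalfExpansion.swap {x : Fin n → F} {k : Fin n} {s r : Set (Fin n)} {A B : F}
    (h : HasHalfExpansion x k s r A B) : HasHalfExpansion x k s r B A :=
  let ⟨U, W, h, hU, hW⟩ := h
  ⟨W, U, h.swap, hW, hU⟩

/-- The exponent vector of the variable of an edge, zero if the edge is a side of the polygon. -/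
def edgeVec (τ : Fin n → ℕ × ℕ) (e : ℕ × ℕ) : Fin n → ℤ := fun j => edgeInd e (τ j)

variable {τ : Fin n → ℕ × ℕ} {v : ℕ → F × F} {x : Fin n → F}

theorem IsTriangulation.isVarExponent (h : IsTriangulation τ) {e : ℕ × ℕ} {t : Set (Fin n)}
    (ht : ∀ i, τ i = e → i ∈ t) : IsVarExponent t (edgeVec τ e) := by
  by_cases he : ∃ i, τ i = e
  · obtain ⟨i, rfl⟩ := he
    refine .inr ⟨i, ht i rfl, ?_⟩
    funext j
    by_cases hj : j = i
    · subst hj; simp [edgeVec, edgeInd]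
    · have : τ j ≠ τ i := fun e => hj (h.inj e)
      simp [edgeVec, edgeInd, this, Pi.single_eq_of_ne hj]
  · left
    funext j
    have : τ j ≠ e := fun h => he ⟨j, h⟩
    simp [edgeVec, edgeInd, this]

theorem IsTriangulation.eval_edgeVec (h : IsTriangulation τ) (hv : HasUnitSides n v)
    (hx : ∀ i, x i = vdet v (τ i).1 (τ i).2) {a b : ℕ} (hab : IsEdge τ a b) :
    MvLaurent.eval x (MvLaurent.mono (edgeVec τ (a, b))) = seglen v a b := by
  rw [MvLaurent.eval_mono, seglen_of_lt v (h.lt hab).1]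
  exact prod_zpow_edgeInd h hv hx hab

theorem HasHalfExpansion.base (h : IsTriangulation τ) (hv : HasUnitSides n v)
    (hx : ∀ i, x i = vdet v (τ i).1 (τ i).2) {k : Fin n} {s : Set (Fin n)} (r : Set (Fin n))
    (hk : k ∉ s) {a b c d : ℕ} (hab : IsEdge τ a b) (hcd : IsEdge τ c d)
    (h1 : ∀ i, τ i = (a, b) → i ∈ s) (h2 : ∀ i, τ i = (c, d) → i ∈ s) :
    HasHalfExpansion x k s r (seglen v a b) (seglen v c d) :=
  ⟨_, _, .base r hk (h.isVarExponent h1) (h.isVarExponent h2), h.eval_edgeVec hv hx hab,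
    h.eval_edgeVec hv hx hcd⟩

theorem HasHalfExpansion.step (h : IsTriangulation τ) (hv : HasUnitSides n v)
    (hx : ∀ i, x i = vdet v (τ i).1 (τ i).2) (hx0 : ∀ i, x i ≠ 0) {k k' : Fin n}
    {s s' r : Set (Fin n)} {A B A' : F} (hAB : HasHalfExpansion x k s r A B)
    (hk' : k' ∉ s') (hs : s ⊆ s') (hks : k ∈ s') (hkr : k ∈ r) {c d : ℕ} (hcd : IsEdge τ c d)
    (hc : ∀ i, τ i = (c, d) → i ∈ s' ∧ i ∉ s ∧ i ≠ k)
    (hA' : A' * seglen v (τ k).1 (τ k).2 =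
      A * seglen v (τ k').1 (τ k').2 + B * seglen v c d) :
    HasHalfExpansion x k' s' r A' B := by
  obtain ⟨U, W, hUW, rfl, rfl⟩ := hAB
  refine ⟨_, W, hUW.step hk' hs hks hkr (h.isVarExponent hc), ?_, rfl⟩
  have hlt : ∀ i, seglen v (τ i).1 (τ i).2 = x i := fun i => by
    rw [hx i, seglen_of_lt v (h.lt (IsTriangulation.isEdge_apply τ i)).1]
  rw [hlt, hlt] at hA'
  rw [MvLaurent.eval_mul hx0, MvLaurent.eval_add hx0, MvLaurent.eval_mul hx0,
    MvLaurent.eval_mul hx0, MvLaurent.eval_mono_single, MvLaurent.eval_mono_single,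
    h.eval_edgeVec hv hx hcd, zpow_one, ← hA', zpow_neg_one, mul_inv_cancel_right₀ (hx0 k)]

/-- The diagonals strictly inside the polygon cut off by `(u, w)`. -/
def innerDiagonals (τ : Fin n → ℕ × ℕ) (u w : ℕ) : Set (Fin n) :=
  {j | u ≤ (τ j).1 ∧ (τ j).2 ≤ w ∧ τ j ≠ (u, w)}

/-- The diagonals on the other side of `(u, w)`. -/
def outerDiagonals (τ : Fin n → ℕ × ℕ) (u w : ℕ) : Set (Fin n) :=
  {j | ¬ (u ≤ (τ j).1 ∧ (τ j).2 ≤ w)}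

/-- Induction on the width of $(u,w)$ with the triangle $uzw$ below it. If $a = z$ this is the base
case; otherwise $a$ lies beneath $(u,z)$ or $(z,w)$, and Ptolemy for that diagonal gives the step.
-/
theorem IsTriangulation.hasHalfExpansion_inner (h : IsTriangulation τ) (hv : HasUnitSides n v)
    (hx : ∀ i, x i = vdet v (τ i).1 (τ i).2) (hx0 : ∀ i, x i ≠ 0) {a b u w : ℕ} {k : Fin n}
    (hk : τ k = (u, w)) (h1 : u < a) (h2 : a < w) (hb : b < u ∨ w < b) :
    HasHalfExpansion x k (innerDiagonals τ u w) {j | Separates (τ j) a b}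
      (seglen v a u) (seglen v a w) := by
  induction hN : w - u using Nat.strong_induction_on generalizing u w k with
  | _ N ih =>
  subst hN
  have hkE : IsEdge τ u w := .inr (.inr ⟨k, hk⟩)
  obtain ⟨z, hz1, hz2, e1, e2⟩ := h.apex hkE (by omega)
  have hks : k ∉ innerDiagonals τ u w := fun e => e.2.2 hk
  have hw := (h.lt hkE).2
  rcases lt_trichotomy a z with hz | rfl | hz
  · obtain ⟨i, hi⟩ := e1.exists_eq (by omega) (by omega)
    refine HasHalfExpansion.swap (.step h hv hx hx0 (ih (z - u) (by omega) hi h1 hz (by omega)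
      rfl).swap hks ?_ ?_ ?_ e2 ?_ ?_)
    · rintro j ⟨j1, j2, j3⟩
      refine ⟨j1, by omega, fun e => ?_⟩
      rw [e] at j2; simp only at j2; omega
    · refine ⟨by rw [hi], by rw [hi]; exact hz2.le, ?_⟩
      rw [hi, Ne, Prod.mk.injEq]; omega
    · simp only [Set.mem_ofPred_eq, Separates, hi]; omega
    · rintro j hj
      refine ⟨⟨by rw [hj]; exact hz1.le, by rw [hj], by rw [hj, Ne, Prod.mk.injEq]; omega⟩, ?_, ?_⟩
      · rintro ⟨-, j2, -⟩
        rw [hj] at j2; simp only at j2; omega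
      · rintro rfl
        rw [hi, Prod.mk.injEq] at hj; omega
    · rw [hi, hk]
      have := seglen_mul_seglen v (b := w) h1 hz (by omega)
      rw [seglen_comm v w z, seglen_comm v w u] at this
      rw [this]; ring
  · rw [seglen_comm v a u]
    refine .base h hv hx _ hks e1 e2 ?_ ?_ <;>
    · intro i hi
      simp only [innerDiagonals, Set.mem_ofPred_eq, hi, ne_eq, Prod.mk.injEq]; omega
  · obtain ⟨i, hi⟩ := e2.exists_eq (by omega) (by omega)
    refine .step h hv hx hx0 (ih (w - z) (by omega) hi hz h2 (by omega) rfl)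
      hks ?_ ?_ ?_ e1 ?_ ?_
    · rintro j ⟨j1, j2, j3⟩
      refine ⟨by omega, j2, fun e => ?_⟩
      rw [e] at j1; simp only at j1; omega
    · refine ⟨by rw [hi]; exact hz1.le, by rw [hi], ?_⟩
      rw [hi, Ne, Prod.mk.injEq]; omega
    · simp only [Set.mem_ofPred_eq, Separates, hi]; omega
    · rintro j hj
      refine ⟨⟨by rw [hj], by rw [hj]; exact hz2.le, by rw [hj, Ne, Prod.mk.injEq]; omega⟩, ?_, ?_⟩
      · rintro ⟨j1, -, -⟩
        rw [hj] at j1; simp only at j1; omega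
      · rintro rfl
        rw [hi, Prod.mk.injEq] at hj; omega
    · rw [hi, hk]
      exact seglen_mul_seglen v (b := u) hz h2 (by omega)

/-- Induction outwards, with the triangle on the far side of $(u,w)$. If `a` is not its apex, it
lies beneath the short edge of that triangle, where the inner expansion applies, or outside its long
edge, where the induction continues. -/
theorem IsTriangulation.hasHalfExpansion_outer (h : IsTriangulation τ) (hv : HasUnitSides n v)
    (hx : ∀ i, x i = vdet v (τ i).1 (τ i).2) (hx0 : ∀ i, x i ≠ 0) {a b u w : ℕ} {k : Fin n}
    (hk : τ k = (u, w)) (h1 : u < b) (h2 : b < w) (ha : a < u ∨ w < a) (han : a ≤ n + 2) :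
    HasHalfExpansion x k (outerDiagonals τ u w) {j | Separates (τ j) a b}
      (seglen v a u) (seglen v a w) := by
  induction hN : n + 2 - (w - u) using Nat.strong_induction_on generalizing u w k with
  | _ N ih =>
  subst hN
  have hkE : IsEdge τ u w := .inr (.inr ⟨k, hk⟩)
  have hw := (h.lt hkE).2
  have hks : k ∉ outerDiagonals τ u w := fun e => e (by rw [hk]; exact ⟨le_rfl, le_rfl⟩)
  rcases h.outer_apex hkE (by omega) with ⟨z, hz, e1, e2⟩ | ⟨z, hz, e1, e2⟩
  · have hzn := (h.lt e1).2
    by_cases haz : a = z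
    · subst haz
      rw [seglen_comm v a u, seglen_comm v a w]
      refine .base h hv hx _ hks e2 e1 ?_ ?_ <;>
      · intro i hi
        simp only [outerDiagonals, Set.mem_ofPred_eq, hi]; omega
    by_cases hin : w < a ∧ a < z
    · obtain ⟨i, hi⟩ := e1.exists_eq (by omega) (by omega)
      refine HasHalfExpansion.step h hv hx hx0 (h.hasHalfExpansion_inner hv hx hx0 hi hin.1 hin.2
        (.inl h2)).swap hks ?_ ?_ ?_ e2 ?_ ?_
      · rintro j ⟨j1, j2, j3⟩ j4
        have := h.add_two_le j
        omega
      · simp only [outerDiagonals, Set.mem_ofPred_eq, hi]; omega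
      · simp only [Set.mem_ofPred_eq, Separates, hi]; omega
      · intro j hj
        refine ⟨?_, ?_, ?_⟩
        · simp only [outerDiagonals, Set.mem_ofPred_eq, hj]; omega
        · simp only [innerDiagonals, Set.mem_ofPred_eq, hj]; omega
        · rintro rfl
          rw [hi, Prod.mk.injEq] at hj; omega
      · rw [hi, hk]
        have := seglen_mul_seglen v (b := u) hin.1 hin.2 (by omega)
        rw [this]; ring
    · obtain ⟨i, hi⟩ := e2.exists_eq (by omega) (by omega)
      refine HasHalfExpansion.swap (.step h hv hx hx0 (ih (n + 2 - (z - u)) (by omega) hi h1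
        (by omega) (by omega) rfl).swap hks ?_ ?_ ?_ e1 ?_ ?_)
      · intro j hj1 hj2
        exact hj1 (by omega)
      · simp only [outerDiagonals, Set.mem_ofPred_eq, hi]; omega
      · simp only [Set.mem_ofPred_eq, Separates, hi]; omega
      · intro j hj
        refine ⟨?_, ?_, ?_⟩
        · simp only [outerDiagonals, Set.mem_ofPred_eq, hj]; omega
        · simp only [outerDiagonals, Set.mem_ofPred_eq, hj]; omega
        · rintro rfl
          rw [hi, Prod.mk.injEq] at hj; omega
      · rw [hi, hk]
        have := seglen_mul_seglen v (a := w) (u := u) (w := z) (b := a) (by omega) (by omega)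
          (by omega)
        rw [seglen_comm v a w, this, seglen_comm v w u]
        ring
  · by_cases haz : a = z
    · subst haz
      refine .base h hv hx _ hks e1 e2 ?_ ?_ <;>
      · intro i hi
        simp only [outerDiagonals, Set.mem_ofPred_eq, hi]; omega
    by_cases hin : z < a ∧ a < u
    · obtain ⟨i, hi⟩ := e1.exists_eq (by omega) (by omega)
      refine HasHalfExpansion.swap (HasHalfExpansion.step h hv hx hx0
        (h.hasHalfExpansion_inner hv hx hx0 hi hin.1 hin.2
        (.inr h1)) hks ?_ ?_ ?_ e2 ?_ ?_)
      · rintro j ⟨j1, j2, j3⟩ j4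
        have := h.add_two_le j
        omega
      · simp only [outerDiagonals, Set.mem_ofPred_eq, hi]; omega
      · simp only [Set.mem_ofPred_eq, Separates, hi]; omega
      · intro j hj
        refine ⟨?_, ?_, ?_⟩
        · simp only [outerDiagonals, Set.mem_ofPred_eq, hj]; omega
        · simp only [innerDiagonals, Set.mem_ofPred_eq, hj]; omega
        · rintro rfl
          rw [hi, Prod.mk.injEq] at hj; omega
      · rw [hi, hk]
        have := seglen_mul_seglen v (b := w) hin.1 hin.2 (by omega)
        rw [this, seglen_comm v w u, seglen_comm v w z]
    · obtain ⟨i, hi⟩ := e2.exists_eq (by omega) (by omega)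
      refine .step h hv hx hx0 (ih (n + 2 - (w - z)) (by omega) hi (by omega)
        h2 (by omega) rfl) hks ?_ ?_ ?_ e1 ?_ ?_
      · intro j hj1 hj2
        exact hj1 (by omega)
      · simp only [outerDiagonals, Set.mem_ofPred_eq, hi]; omega
      · simp only [Set.mem_ofPred_eq, Separates, hi]; omega
      · intro j hj
        refine ⟨?_, ?_, ?_⟩
        · simp only [outerDiagonals, Set.mem_ofPred_eq, hj]; omega
        · simp only [outerDiagonals, Set.mem_ofPred_eq, hj]; omega
        · rintro rfl
          rw [hi, Prod.mk.injEq] at hj; omega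
      · rw [hi, hk]
        have := seglen_mul_seglen v (a := u) (u := z) (w := w) (b := a) (by omega) (by omega)
          (by omega)
        rw [seglen_comm v a u, this, seglen_comm v u z]
        ring

/-- The coefficients of `f` are non-negative, and two nonzero coefficients at exponents `-1` and `1`
of the variable `k` surround the pattern `1, 2, 1`. -/
structure IsPatterned (f : MvLaurent n ℤ) (k : Fin n) : Prop where
  nonneg : ∀ m, 0 ≤ f.coeff m
  exponent : ∀ m, f.coeff m ≠ 0 → m k = -1 ∨ m k = 0 ∨ m k = 1
  pattern : ∀ m : Fin n → ℤ, m k = 0 →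
    f.coeff (m - Pi.single k 1) ≠ 0 → f.coeff (m + Pi.single k 1) ≠ 0 →
    f.coeff (m - Pi.single k 1) = 1 ∧ f.coeff (m + Pi.single k 1) = 1 ∧ f.coeff m = 2

theorem IsPatterned.of_exponent {f : MvLaurent n ℤ} (hf : ∀ m, 0 ≤ f.coeff m) {k : Fin n}
    (h : ∀ m, f.coeff m ≠ 0 → m k = 0 ∨ m k = 1) : IsPatterned f k where
  nonneg := hf
  exponent m hm := .inr (h m hm)
  pattern m hmk hm := by
    have := h _ hm
    simp [hmk] at this

/-- The inner expansion seen from `a` and the outer one seen from `b` are glued by Ptolemy along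
`k`. -/
theorem IsTriangulation.exists_expansion (h : IsTriangulation τ) (hv : HasUnitSides n v)
    (hx : ∀ i, x i = vdet v (τ i).1 (τ i).2) (hx0 : ∀ i, x i ≠ 0) {a b : ℕ} {k : Fin n}
    (h1 : (τ k).1 < a) (h2 : a < (τ k).2) (hb : b < (τ k).1 ∨ (τ k).2 < b) (hbn : b ≤ n + 2) :
    ∃ f : MvLaurent n ℤ, MvLaurent.eval x f = seglen v a b ∧ IsPatterned f k ∧
      ∀ j, ¬ Separates (τ j) a b → IsPatterned f j := by
  obtain ⟨U, W, hUW, hU, hW⟩ := h.hasHalfExpansion_inner hv hx hx0 (k := k) rfl h1 h2 hb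
  obtain ⟨U', W', hUW', hU', hW'⟩ := h.hasHalfExpansion_outer hv hx hx0 (k := k) rfl h1 h2 hb hbn
  have hr : {j | Separates (τ j) b a} = {j | Separates (τ j) a b} := by
    ext j
    exact or_comm
  rw [hr] at hUW'
  have hd : Disjoint (innerDiagonals τ (τ k).1 (τ k).2) (outerDiagonals τ (τ k).1 (τ k).2) :=
    Set.disjoint_left.2 fun j hj hj' => hj' ⟨hj.1, hj.2.1⟩
  have hkr : k ∈ {j | Separates (τ j) a b} := .inl ⟨h1, h2, hb⟩
  have hnonneg := hUW.coeff_glue_nonneg hUW' hd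
  refine ⟨MvLaurent.glue k U W U' W', ?_, ⟨hnonneg, fun m hm => hUW.glue_exponent_self hUW' hd hm,
    fun m hmk => hUW.glue_pattern hUW' hd hmk⟩, fun j hj => .of_exponent hnonneg fun m hm =>
      hUW.glue_exponent hUW' hd hkr hm hj⟩
  rw [MvLaurent.glue, MvLaurent.eval_mul hx0, MvLaurent.eval_add hx0, MvLaurent.eval_mul hx0,
    MvLaurent.eval_mul hx0, MvLaurent.eval_mono_single, hU, hW, hU', hW',
    ← seglen_mul_seglen v h1 h2 hb, zpow_neg_one, hx k, seglen_of_lt v (h1.trans h2),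
    mul_inv_cancel_right₀]
  rw [← hx]
  exact hx0 k

/-- An edge of the triangulation is a monomial. Any other segment is crossed by a diagonal, and the
expansion obtained from it also handles every uncrossed variable. -/
theorem IsTriangulation.exists_patterned [CharZero F] (h : IsTriangulation τ)
    (hv : HasUnitSides n v)
    (hx : ∀ i, x i = vdet v (τ i).1 (τ i).2) (hind : AlgebraicIndependent ℚ x) {a b : ℕ}
    (hab : a < b) (hb : b ≤ n + 2) :
    ∃ f : MvLaurent n ℤ, MvLaurent.eval x f = vdet v a b ∧ ∀ j, IsPatterned f j := by
  have hx0 := hind.ne_zero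
  have hexp : ∀ k, Separates (τ k) a b → ∃ f : MvLaurent n ℤ,
      MvLaurent.eval x f = vdet v a b ∧ IsPatterned f k ∧
      ∀ j, ¬ Separates (τ j) a b → IsPatterned f j := by
    rintro k (⟨h1, h2, h3⟩ | ⟨h1, h2, h3⟩)
    · obtain ⟨f, hf⟩ := h.exists_expansion hv hx hx0 h1 h2 h3 hb
      exact ⟨f, by rw [hf.1, seglen_of_lt v hab], hf.2⟩
    · obtain ⟨f, hf, hk, hj⟩ := h.exists_expansion hv hx hx0 h1 h2 h3 (by omega)
      exact ⟨f, by rw [hf, seglen_comm, seglen_of_lt v hab], hk, fun j hs =>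
        hj j fun hs' => hs (Or.symm hs')⟩
  by_cases hE : IsEdge τ a b
  · have hvar : IsVarExponent Set.univ (edgeVec τ (a, b)) :=
      h.isVarExponent fun _ _ => Set.mem_univ _
    refine ⟨MvLaurent.mono (edgeVec τ (a, b)), ?_, fun j => .of_exponent (fun m => ?_) fun m hm => ?_⟩
    · rw [h.eval_edgeVec hv hx hE, seglen_of_lt v hab]
    · rw [MvLaurent.coeff_mono]; split_ifs <;> norm_num
    · rw [MvLaurent.coeff_mono] at hm
      obtain rfl : edgeVec τ (a, b) = m := by
        by_contra h'
        exact hm (if_neg h')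
      exact hvar.apply j
  · obtain ⟨i, hi⟩ := h.exists_cross hab hb hE
    obtain ⟨f, hf, -, hf'⟩ := hexp i (by unfold Separates; omega)
    refine ⟨f, hf, fun j => ?_⟩
    by_cases hj : Separates (τ j) a b
    · obtain ⟨g, hg, hgj, -⟩ := hexp j hj
      -- The expansion glued along `j` equals `f` by uniqueness, so `f` inherits its pattern in the
      -- variable `j`.
      rwa [MvLaurent.eval_injective hind (hf.trans hg.symm)]
    · exact hf' j hj

/-- If both neighbours are nonzero, the exponent bounds force $m_j = 0$, and the pattern gives $1
\le 4$. -/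
theorem MvLaurent.isLogConcave_of_isPatterned {f : MvLaurent n ℤ} (h0 : f ≠ 0)
    (hf : ∀ m, 0 ≤ f.coeff m) (h : ∀ j, IsPatterned f j) : MvLaurent.IsLogConcave f := by
  refine ⟨h0, hf, fun j m => ?_⟩
  by_cases hl : f.coeff (m - Pi.single j 1) = 0
  · rw [hl, zero_mul]; exact sq_nonneg _
  by_cases hr : f.coeff (m + Pi.single j 1) = 0
  · rw [hr, mul_zero]; exact sq_nonneg _
  have h1 := (h j).exponent _ hl
  have h2 := (h j).exponent _ hr
  simp only [Pi.sub_apply, Pi.add_apply, Pi.single_eq_same] at h1 h2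
  obtain ⟨e1, e2, e3⟩ := (h j).pattern m (by omega) hl hr
  rw [e1, e2, e3]
  norm_num

end LaurentExpansion

/-- In the coefficient-free cluster algebra of type `A_n` of the cluster pattern through `S`, let
`S₀` be any seed (the initial one) and `S₁.cluster i` any cluster variable. Then there is exactly
one integer Laurent polynomial `f` expressing the cluster variable in the cluster of `S₀`; it is
log-concave, all its exponents are `-1`, `0` or `1`, and two nonzero coefficients at exponents `-1`
and `1` of a variable (the other exponents being equal) are both `1`, the one between being `2`. -/
theorem theorem4p2 (n : ℕ) {F : Type*} [Field F] [CharZero F]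
    (S : Seed n F) (hS : S.IsLabeledSeed) (hA : S.IsOfTypeA)
    (S₀ S₁ : Seed n F) (h₀ : S.MutatesTo S₀) (h₁ : S.MutatesTo S₁) (i : Fin n) :
    ∃ f : MvLaurent n ℤ,
      (∀ g : MvLaurent n ℤ, MvLaurent.eval S₀.cluster g = S₁.cluster i ↔ g = f) ∧
      MvLaurent.IsLogConcave f ∧
      (∀ m : Fin n → ℤ, f.coeff m ≠ 0 → ∀ j, m j = -1 ∨ m j = 0 ∨ m j = 1) ∧
      (∀ (j : Fin n) (m : Fin n → ℤ), m j = 0 →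
        f.coeff (m - Pi.single j 1) ≠ 0 → f.coeff (m + Pi.single j 1) ≠ 0 →
        f.coeff (m - Pi.single j 1) = 1 ∧ f.coeff (m + Pi.single j 1) = 1 ∧ f.coeff m = 2) := by
  obtain ⟨S', hS', hA⟩ := hA
  have hL' := hS.of_mutatesTo hS'
  have hL₀ := hS.of_mutatesTo h₀
  have hL₁ := hS.of_mutatesTo h₁
  obtain ⟨v, hv, hM⟩ := exists_isModel hL' hA
  -- The model passes from the type $A$ seed back to `S`, and from there, with the same vectors, to
  -- both `S₀` and `S₁`.
  have hMS := hM.of_mutatesTo hv hL' (hS.mutatesTo_symm hS')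
  obtain ⟨τ₀, ht₀, hx₀, -⟩ := hMS.of_mutatesTo hv hS h₀
  obtain ⟨τ₁, ht₁, hx₁, -⟩ := hMS.of_mutatesTo hv hS h₁
  have hlt := ht₁.lt (IsTriangulation.isEdge_apply τ₁ i)
  obtain ⟨f, hf, hpat⟩ := ht₀.exists_patterned hv hx₀ hL₀.1 hlt.1 hlt.2
  rw [← hx₁ i] at hf
  have hf0 : f ≠ 0 := by
    rintro rfl
    apply hL₁.cluster_ne_zero i
    rw [← hf]
    simp [MvLaurent.eval]
  refine ⟨f, fun g => ⟨fun hg => MvLaurent.eval_injective hL₀.1 (hg.trans hf.symm), ?_⟩,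
    MvLaurent.isLogConcave_of_isPatterned hf0 (hpat i).nonneg hpat,
    fun m hm j => (hpat j).exponent m hm, fun j => (hpat j).pattern⟩
  rintro rfl
  exact hf
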